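/- Let $\gamma_{ij}:\mathbb R\to\mathbb R$ ($i,j=1,\dots,m$, $i\ne j$) be locally Lipschitz functions forming an interconnection, i.e. for all $i\neq j$: $\gamma_{ij}(0)=0$ and $s\gamma_{ij}(s)\ge 0$ for all $s$; and either $\gamma_{ij}\equiv 0$ or there is a continuous, strictly increasing $\alpha:[0,\infty)\to[0,\infty)$ with $\alpha(0)=0$ and $|\gamma_{ij}(s)|\ge\alpha(|s|)$ for all $s$. Suppose the interconnection is connected: in the directed graph on $\{1,\dots,m\}$ with an edge $(i,j)$ iff $i\neq j$ and $\gamma_{ij}\not\equiv 0$, there is a node to which there is a directed path from every other node. For $\omega>0$ consider the array of coupled harmonic oscillators $$\dot q_i=\omega p_i,\qquad \dot p_i=-\omega q_i+\sum_{j\ne i}\gamma_{ij}(p_j-p_i),\qquad i=1,\dots,m,$$ with states $\xi_i=(q_i,p_i)\in\mathbb R^2$, $\xi=(\xi_1,\dots,\xi_m)\in\mathbb R^{2m}$. Let $\mathcal A=\{\xi\in\mathbb R^{2m}:\xi_i=\xi_j\text{ for all }i,j\}$ and let $|\xi|_{\mathcal A}$ denote the Euclidean distance from $\xi$ to $\mathcal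 A$. Then for every $\omega>0$, every $t_0\in\mathbb R$ and every initial state there is a solution defined for all $t\ge t_0$, and the closed set $\mathcal A$ is semiglobally practically asymptotically stable with respect to $\omega$. That is, for each pair $(\Delta,\delta)$ of positive numbers there exists $\omega^*>0$ such that for all $\omega\ge\omega^*$ the following hold, for all $t_0\in\mathbb R$ and all solutions $\xi(\cdot)$ on $[t_0,\infty)$, where $\varepsilon$ in (a), $r$ in (b) and $T$ in (c) do not depend on $t_0$ or on the solution: (a) for each $r>\delta$ there exists $\varepsilon>0$ such that $|\xi(t_0)|_{\mathcal A}\le\varepsilon$ implies $|\xi(t)|_{\mathcal A}\le r$ for all $t\ge t_0$; (b) for each $\varepsilon<\Delta$ there exists $r>0$ such that $|\xi(t_0)|_{\mathcal A}\le\varepsilon$ implies $|\xi(t)|_{\mathcal A}\le r$ for all $t\ge t_0$; (c) for each $r<\Delta$ and $\varepsilon>\delta$ there exists $T>0$ such that $|\xi(t_0)|_{\mathcal A}\le r$ implies $|\xi(t)|_{\mathcal A}\le\varepsilon$ for all $t\ge t_0+T$. -/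

import Mathlib

open scoped NNReal

/-- Class-`𝒦` functions `ℝ≥0 → ℝ≥0`: continuous, zero at zero, strictly increasing. -/
def IsClassK (α : ℝ≥0 → ℝ≥0) : Prop :=
  Continuous α ∧ α 0 = 0 ∧ StrictMono α

/-- A node of a directed graph is reachable from every other node. -/
def DigraphConnected {V : Type*} (G : Digraph V) : Prop :=
  ∃ l : V, ∀ i : V, i ≠ l → Relation.ReflTransGen G.Adj i l

/-- The functions `γ i j`, `i ≠ j`, form an interconnection: each one vanishes at `0`, satisfies
`s * γ i j s ≥ 0`, and is either identically zero or bounded below in absolute value by a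
class-`𝒦` function of `|s|`. The diagonal entries `γ i i` are never used. -/
def IsInterconnection {m : ℕ} (γ : Fin m → Fin m → ℝ → ℝ) : Prop :=
  ∀ i j : Fin m, i ≠ j →
    γ i j 0 = 0 ∧
    (∀ s : ℝ, 0 ≤ s * γ i j s) ∧
    ((∀ s : ℝ, γ i j s = 0) ∨
      ∃ α : ℝ≥0 → ℝ≥0, IsClassK α ∧ ∀ s : ℝ, (α ‖s‖₊ : ℝ) ≤ |γ i j s|)

/-- The graph of an interconnection: `(i, j)` is an edge iff `i ≠ j` and `γ i j` is not
identically zero. -/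
def interconnectionGraph {m : ℕ} (γ : Fin m → Fin m → ℝ → ℝ) : Digraph (Fin m) where
  Adj i j := i ≠ j ∧ ∃ s : ℝ, γ i j s ≠ 0

/-- The state space `ℝ^{2m}` with its Euclidean norm, as `m` blocks `ξ i = (q i, p i) ∈ ℝ²`. -/
abbrev ArrayState (m : ℕ) : Type :=
  PiLp 2 (fun _ : Fin m => EuclideanSpace ℝ (Fin 2))

/-- The right-hand side of the array of coupled harmonic oscillators
`q_i' = ω p_i`, `p_i' = -ω q_i + ∑_{j ≠ i} γ_{ij} (p_j - p_i)`,
where `q_i = ξ i 0` and `p_i = ξ i 1`. -/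
noncomputable def harmonicArray {m : ℕ} (γ : Fin m → Fin m → ℝ → ℝ)
    (ξ : ArrayState m) (ω : ℝ) : ArrayState m :=
  WithLp.toLp 2 fun i =>
    !₂[ω * ξ i 1,
       -ω * ξ i 0 + ∑ j ∈ Finset.univ.filter (fun j => j ≠ i), γ i j (ξ j 1 - ξ i 1)]

/-- The synchronization manifold. -/
def syncManifold (m : ℕ) : Set (ArrayState m) :=
  {ξ | ∀ i j : Fin m, ξ i = ξ j}

/-- `x` solves `x' = g (x, ω, t)` on `[t₀, ∞)`. -/
def IsForwardSolution {E : Type*} [NormedAddCommGroup E] [NormedSpace ℝ E]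
    (g : E → ℝ → ℝ → E) (ω t₀ : ℝ) (x : ℝ → E) : Prop :=
  IsIntegralCurveOn x (fun t v => g v ω t) (Set.Ici t₀)

/-- For this `ω`, every initial condition is the start of a solution that exists for all
later times. -/
def IsForwardComplete {E : Type*} [NormedAddCommGroup E] [NormedSpace ℝ E]
    (g : E → ℝ → ℝ → E) (ω : ℝ) : Prop :=
  ∀ (t₀ : ℝ) (x₀ : E), ∃ x : ℝ → E, IsForwardSolution g ω t₀ x ∧ x t₀ = x₀

/-- Semiglobal practical asymptotic stability, with respect to the parameter `ω`, of the closed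
set `S` for the system `x' = g (x, ω, t)`. -/
def IsSemigloballyPracticallyAsymptoticallyStable
    {E : Type*} [NormedAddCommGroup E] [NormedSpace ℝ E]
    (g : E → ℝ → ℝ → E) (S : Set E) : Prop :=
  IsClosed S ∧
  ∀ Δ δ : ℝ, 0 < Δ → 0 < δ → ∃ ωstar : ℝ, 0 < ωstar ∧ ∀ ω : ℝ, ωstar ≤ ω →
    (∀ r : ℝ, δ < r → ∃ ε : ℝ, 0 < ε ∧
      ∀ (t₀ : ℝ) (x : ℝ → E), IsForwardSolution g ω t₀ x →
        Metric.infDist (x t₀) S ≤ ε → ∀ t : ℝ, t₀ ≤ t → Metric.infDist (x t) S ≤ r) ∧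
    (∀ ε : ℝ, ε < Δ → ∃ r : ℝ, 0 < r ∧
      ∀ (t₀ : ℝ) (x : ℝ → E), IsForwardSolution g ω t₀ x →
        Metric.infDist (x t₀) S ≤ ε → ∀ t : ℝ, t₀ ≤ t → Metric.infDist (x t) S ≤ r) ∧
    (∀ r ε : ℝ, r < Δ → δ < ε → ∃ T : ℝ, 0 < T ∧
      ∀ (t₀ : ℝ) (x : ℝ → E), IsForwardSolution g ω t₀ x →
        Metric.infDist (x t₀) S ≤ r → ∀ t : ℝ, t₀ + T ≤ t → Metric.infDist (x t) S ≤ ε)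

/-! ### Averaging estimates and comparison for ODEs -/

section ODE

open Set

variable {E : Type*} [NormedAddCommGroup E] [NormedSpace ℝ E]

/-! The proof is by averaging. Put `x_i = e^{iωt} (q_i + i p_i)`. This rotation cancels the free
oscillation, and `ω` survives only as the speed of a `2π/ω`-periodic coupling term. Large `ω` thus
means fast forcing, which follows its mean up to `O(1/ω)` on bounded times (`norm_sub_averaged_le`).

By rotation and reflection symmetry, the mean force on a relative position `y` is `w y` with `0 ≤ w
≤ K`, and `w > 0` along edges when `y ≠ 0` (`exists_kickMean_eq`). The averaged system is therefore
a planar consensus protocol with state-dependent weights. Every real linear functional of the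
positions obeys scalar consensus, so its range over the nodes cannot grow. The root of the graph
misses the maximum or the minimum unless the two agree, and then every node leaves that extreme at
once. Hence the largest mutual distance, `spread`, strictly decreases (`avgField_spread`), and by
translation invariance and compactness it does so by a uniform amount (`exists_spread_decrease`).
Iterating over blocks of about `ω` periods carries this over to the oscillators with a small error
(`spread_block`, `spread_practical`).

These estimates need bounded, globally Lipschitz couplings, so arguments are clamped to `[-R, R]`.
The a priori bound on the spread keeps the clamp inactive, and uniqueness transfers the result to
the original system. Completeness uses instead an exponential bound on the coordinates whose rate
does not depend on the couplings, so the clamp level can be fixed before solving. -/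

theorem IsIntegralCurveOn.hasDerivWithinAt_Ici {x : ℝ → E} {f : ℝ → E → E} {a b t : ℝ}
    (hx : IsIntegralCurveOn x f (Icc a b)) (ht : t ∈ Ico a b) :
    HasDerivWithinAt x (f t (x t)) (Ici t) t :=
  (hx t (Ico_subset_Icc_self ht)).mono_of_mem_nhdsWithin (Icc_mem_nhdsGE_of_mem ht)

/-- A bounded Lipschitz vector field has solutions on arbitrary compact time intervals. -/
theorem exists_isIntegralCurveOn_Icc [CompleteSpace E] {f : ℝ → E → E} {K : ℝ≥0} {B : ℝ}
    (hL : ∀ t, LipschitzWith K (f t)) (hc : ∀ x, Continuous fun t => f t x)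
    (hB : ∀ t x, ‖f t x‖ ≤ B) {a b : ℝ} (hab : a ≤ b) (x₀ : E) :
    ∃ x : ℝ → E, x a = x₀ ∧ IsIntegralCurveOn x f (Icc a b) := by
  have hB0 : 0 ≤ B := (norm_nonneg _).trans (hB 0 0)
  have hab' : 0 ≤ b - a := sub_nonneg.2 hab
  -- With speed at most `B`, a curve stays within `B * (b - a)` of `x₀`; a ball of that radius lets
  -- one application of Picard–Lindelöf cover the whole interval.
  have hpl : IsPicardLindelof f (⟨a, left_mem_Icc.2 hab⟩ : Icc a b) x₀
      (B.toNNReal * (b - a).toNNReal) 0 B.toNNReal K :=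
    { lipschitzOnWith := fun t _ => (hL t).lipschitzOnWith
      continuousOn := fun x _ => (hc x).continuousOn
      norm_le := fun t _ x _ => by rw [Real.coe_toNNReal _ hB0]; exact hB t x
      mul_max_le := by simp [hB0, hab'] }
  exact hpl.exists_eq_forall_mem_Icc_hasDerivWithinAt₀

theorem IsIntegralCurveOn.eqOn_Icc {f : ℝ → E → E} {K : ℝ≥0}
    (hL : ∀ t, LipschitzWith K (f t)) {a b : ℝ} {x y : ℝ → E}
    (hx : IsIntegralCurveOn x f (Icc a b)) (hy : IsIntegralCurveOn y f (Icc a b))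
    (h : x a = y a) : EqOn x y (Icc a b) :=
  ODE_solution_unique_of_mem_Icc_right (v := f) (s := fun _ => univ) (K := K)
    (fun t _ => (hL t).lipschitzOnWith) hx.continuousOn (fun _ ht => hx.hasDerivWithinAt_Ici ht)
    (fun _ _ => trivial) hy.continuousOn (fun _ ht => hy.hasDerivWithinAt_Ici ht)
    (fun _ _ => trivial) h

theorem IsIntegralCurveOn.norm_sub_le {f : ℝ → E → E} {B a b : ℝ} {x : ℝ → E}
    (hB : ∀ t x, ‖f t x‖ ≤ B) (hx : IsIntegralCurveOn x f (Icc a b)) {s t : ℝ}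
    (hs : a ≤ s) (hst : s ≤ t) (ht : t ≤ b) : ‖x t - x s‖ ≤ B * (t - s) :=
  norm_image_sub_le_of_norm_deriv_le_segment' (f' := fun r => f r (x r))
    (fun r hr => (hx r ⟨hs.trans hr.1, hr.2.trans ht⟩).mono (Icc_subset_Icc hs ht))
    (fun r _ => hB r (x r)) t ⟨hst, le_rfl⟩

/-- Freezing the state over a time step `h` costs an error of order `h ^ 2`. -/
theorem IsIntegralCurveOn.norm_sub_integral_le [CompleteSpace E] {f : ℝ → E → E} {K : ℝ≥0}
    {B a h : ℝ} (hL : ∀ t, LipschitzWith K (f t)) (hc : ∀ x, Continuous fun t => f t x)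
    (hB : ∀ t x, ‖f t x‖ ≤ B) (hh : 0 ≤ h) {x : ℝ → E}
    (hx : IsIntegralCurveOn x f (Icc a (a + h))) :
    ‖x (a + h) - x a - ∫ s in a..(a + h), f s (x a)‖ ≤ K * B * h ^ 2 := by
  have hB0 : 0 ≤ B := (norm_nonneg _).trans (hB 0 0)
  have key := norm_image_sub_le_of_norm_deriv_le_segment' (C := K * (B * h))
    (f := fun t => x t - ∫ s in a..t, f s (x a)) (f' := fun t => f t (x t) - f t (x a))
    (a := a) (b := a + h) (fun t ht => ?_) (fun t ht => ?_) (a + h) ⟨by linarith, le_rfl⟩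
  · calc _ = ‖x (a + h) - (∫ s in a..(a + h), f s (x a)) - (x a - ∫ s in a..a, f s (x a))‖ := by
          simp only [intervalIntegral.integral_same]; congr 1; abel
      _ ≤ _ := key
      _ = _ := by ring
  · refine (hx t ht).sub (HasDerivAt.hasDerivWithinAt ?_)
    exact intervalIntegral.integral_hasDerivAt_right ((hc _).intervalIntegrable _ _)
      ((hc _).stronglyMeasurableAtFilter _ _) (hc _).continuousAt
  · calc ‖f t (x t) - f t (x a)‖ ≤ K * ‖x t - x a‖ := (hL t).norm_sub_le _ _
      _ ≤ K * (B * h) := by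
        gcongr
        exact (hx.norm_sub_le hB le_rfl ht.1 ht.2.le).trans (by gcongr; linarith [ht.2])

/-- Comparison of a rapidly periodic vector field with its average at multiples of the period. -/
theorem norm_sub_averaged_le [CompleteSpace E] {f : ℝ → E → E} {F : E → E} {K : ℝ≥0} {B h : ℝ}
    (hL : ∀ t, LipschitzWith K (f t)) (hc : ∀ x, Continuous fun t => f t x)
    (hB : ∀ t x, ‖f t x‖ ≤ B) (hFL : LipschitzWith K F) (hFB : ∀ x, ‖F x‖ ≤ B) (hh : 0 ≤ h)
    (havg : ∀ a x, ∫ s in a..(a + h), f s x = h • F x) {a : ℝ} {N : ℕ} {x y : ℝ → E}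
    (hx : IsIntegralCurveOn x f (Icc a (a + N * h)))
    (hy : IsIntegralCurveOn y (fun _ => F) (Icc 0 (N * h))) (h0 : x a = y 0) (n : ℕ)
    (hn : n ≤ N) :
    ‖x (a + n * h) - y (n * h)‖ ≤ 2 * K * B * h ^ 2 * n * Real.exp (K * (n * h)) := by
  have hB0 : 0 ≤ B := (norm_nonneg _).trans (hB 0 0)
  induction n with
  | zero => simp [h0]
  | succ n ih =>
    have ih := ih (by omega)
    have hnN : ((n : ℝ) + 1) * h ≤ N * h := by
      gcongr; exact_mod_cast hn
    have hnh : 0 ≤ (n : ℝ) * h := by positivity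
    have e1 : a + (n + 1 : ℕ) * h = a + n * h + h := by push_cast; ring
    have e2 : ((n + 1 : ℕ) : ℝ) * h = n * h + h := by push_cast; ring
    have hx1 := IsIntegralCurveOn.norm_sub_integral_le (a := a + n * h) hL hc hB hh
      (hx.mono (Icc_subset_Icc (by linarith) (by linarith)))
    have hy1 := IsIntegralCurveOn.norm_sub_integral_le (f := fun _ => F) (a := n * h)
      (fun _ => hFL) (fun _ => continuous_const) (fun _ => hFB) hh
      (hy.mono (Icc_subset_Icc (by linarith) (by linarith)))
    rw [havg] at hx1
    simp only [intervalIntegral.integral_const, add_sub_cancel_left] at hy1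
    rw [e1, e2]
    set X := x (a + n * h)
    set Y := y (n * h)
    have hF : ‖h • F X - h • F Y‖ ≤ h * (K * ‖X - Y‖) := by
      rw [← smul_sub, norm_smul, Real.norm_of_nonneg hh]
      gcongr
      exact hFL.norm_sub_le _ _
    -- Discrete Grönwall: each period adds one freezing error for each of the two flows and
    -- multiplies the old error by at most `1 + K * h ≤ exp (K * h)`.
    have htri : ‖x (a + n * h + h) - y (n * h + h)‖ ≤
        K * B * h ^ 2 + K * B * h ^ 2 + ‖X - Y‖ + h * (K * ‖X - Y‖) := by
      have : x (a + n * h + h) - y (n * h + h) = (x (a + n * h + h) - X - h • F X)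
          - (y (n * h + h) - Y - h • F Y) + (X - Y) + (h • F X - h • F Y) := by abel
      rw [this]
      refine (norm_add_le _ _).trans (add_le_add ((norm_add_le _ _).trans
        (add_le_add ((norm_sub_le _ _).trans (add_le_add hx1 hy1)) le_rfl)) hF)
    have hexp : 1 + K * h ≤ Real.exp (K * h) := by
      have := Real.add_one_le_exp (K * h); linarith
    have hexp' : 1 ≤ Real.exp (K * (n * h + h)) := Real.one_le_exp (by positivity)
    have hmul : Real.exp (K * (n * h + h)) = Real.exp (K * (n * h)) * Real.exp (K * h) := by
      rw [← Real.exp_add]; congr 1; ring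
    have hC : 0 ≤ 2 * K * B * h ^ 2 := by positivity
    calc _ ≤ _ := htri
      _ = 2 * K * B * h ^ 2 + ‖X - Y‖ * (1 + K * h) := by ring
      _ ≤ 2 * K * B * h ^ 2 * Real.exp (K * (n * h + h)) +
          (2 * K * B * h ^ 2 * n * Real.exp (K * (n * h))) * Real.exp (K * h) := by
        exact add_le_add (le_mul_of_one_le_right hC hexp')
          (mul_le_mul ih hexp (by positivity) (by positivity))
      _ = _ := by rw [hmul]; push_cast; ring

/-- Squaring removes the corner of the negative part, so a sum of squared negative parts can serve
as a differentiable Lyapunov function. -/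
theorem hasDerivAt_sq_max_neg_zero (u : ℝ) :
    HasDerivAt (fun u : ℝ => max (-u) 0 ^ 2) (-2 * max (-u) 0) u := by
  rcases lt_trichotomy u 0 with hu | rfl | hu
  · have h1 : HasDerivAt (fun u : ℝ => u ^ 2) (2 * u) u := by simpa using hasDerivAt_pow 2 u
    rw [max_eq_left (by linarith)]
    have : -2 * -u = 2 * u := by ring
    rw [this]
    refine h1.congr_of_eventuallyEq ?_
    filter_upwards [gt_mem_nhds hu] with v hv
    rw [max_eq_left (by linarith)]; ring
  · simp only [neg_zero, max_self, mul_zero]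
    rw [hasDerivAt_iff_isLittleO_nhds_zero]
    refine Asymptotics.IsBigO.trans_isLittleO (g := fun h : ℝ => h ^ 2) ?_ ?_
    · refine Asymptotics.IsBigO.of_bound 1 (Filter.Eventually.of_forall fun h => ?_)
      simp only [zero_add, neg_zero, max_self, Real.norm_eq_abs]
      rcases le_total h 0 with hh | hh
      · rw [max_eq_left (by linarith)]; simp
      · rw [max_eq_right (by linarith)]; simp [sq_nonneg]
    · simpa using Asymptotics.isLittleO_pow_id (𝕜 := ℝ) (n := 2) (by norm_num)
  · rw [max_eq_right (by linarith)]
    simp only [mul_zero]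
    refine (hasDerivAt_const u (0 : ℝ)).congr_of_eventuallyEq ?_
    filter_upwards [lt_mem_nhds hu] with v hv
    rw [max_eq_right (by linarith)]; ring

/-- Nonnegative orthants are forward invariant under cooperative differential inequalities. -/
theorem nonneg_of_cooperative {ι : Type*} [Fintype ι] {a T A : ℝ} {b b' : ι → ℝ → ℝ}
    (hA : 0 ≤ A)
    (hb : ∀ k, ∀ t ∈ Icc a T, HasDerivWithinAt (b k) (b' k t) (Icc a T) t)
    (hb' : ∀ k, ∀ t ∈ Icc a T, b k t < 0 → -A * ∑ l, max (-b l t) 0 ≤ b' k t)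
    (h0 : ∀ k, 0 ≤ b k a) : ∀ k, ∀ t ∈ Icc a T, 0 ≤ b k t := by
  set N : ℝ := (Fintype.card ι : ℝ)
  -- `Φ` vanishes at `a`, and Cauchy–Schwarz turns the hypothesis into `Φ' ≤ 2 * A * N * Φ`; by
  -- Grönwall it stays zero.
  set Φ : ℝ → ℝ := fun t => ∑ k, max (-b k t) 0 ^ 2
  set Φ' : ℝ → ℝ := fun t => ∑ k, -2 * max (-b k t) 0 * b' k t
  have hΦ : ∀ t ∈ Icc a T, HasDerivWithinAt Φ (Φ' t) (Icc a T) t := fun t ht =>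
    HasDerivWithinAt.fun_sum fun k _ =>
      (hasDerivAt_sq_max_neg_zero (b k t)).comp_hasDerivWithinAt t (hb k t ht)
  have hbound : ∀ t ∈ Icc a T, Φ' t ≤ 2 * A * N * Φ t := by
    intro t ht
    have h1 : ∀ k, -2 * max (-b k t) 0 * b' k t ≤
        2 * A * (max (-b k t) 0 * ∑ l, max (-b l t) 0) := by
      intro k
      rcases lt_or_ge (b k t) 0 with hk | hk
      · have := hb' k t ht hk
        have hm : 0 ≤ max (-b k t) 0 := le_max_right _ _
        nlinarith [mul_le_mul_of_nonneg_left this hm]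
      · rw [max_eq_right (by linarith : -b k t ≤ 0)]; simp
    calc Φ' t ≤ ∑ k, 2 * A * (max (-b k t) 0 * ∑ l, max (-b l t) 0) :=
          Finset.sum_le_sum fun k _ => h1 k
      _ = 2 * A * (∑ k, max (-b k t) 0) ^ 2 := by
          rw [← Finset.mul_sum, ← Finset.sum_mul, sq]
      _ ≤ 2 * A * (N * Φ t) := by
          gcongr
          exact sq_sum_le_card_mul_sum_sq
      _ = _ := by ring
  have hanti : AntitoneOn (fun t => Real.exp (-(2 * A * N) * t) * Φ t) (Icc a T) := by
    have hd : ∀ t ∈ Icc a T, HasDerivWithinAt (fun t => Real.exp (-(2 * A * N) * t) * Φ t)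
        (Real.exp (-(2 * A * N) * t) * (-(2 * A * N)) * Φ t +
          Real.exp (-(2 * A * N) * t) * Φ' t) (Icc a T) t := by
      intro t ht
      refine HasDerivWithinAt.mul (HasDerivAt.hasDerivWithinAt ?_) (hΦ t ht)
      simpa using ((hasDerivAt_id t).const_mul (-(2 * A * N))).exp
    refine antitoneOn_of_hasDerivWithinAt_nonpos (convex_Icc a T)
      (fun t ht => (hd t ht).continuousWithinAt)
      (fun t ht => (hd t (interior_subset ht)).mono interior_subset) (fun t ht => ?_)
    have h2 := hbound t (interior_subset ht)
    nlinarith [Real.exp_pos (-(2 * A * N) * t)]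
  intro k t ht
  have ha : a ∈ Icc a T := ⟨le_rfl, ht.1.trans ht.2⟩
  have h3 := hanti ha ht ht.1
  have hΦa : Φ a = 0 := Finset.sum_eq_zero fun k _ => by
    rw [max_eq_right (by linarith [h0 k])]; simp
  simp only [hΦa, mul_zero] at h3
  have h4 : Φ t ≤ 0 := nonpos_of_mul_nonpos_right h3 (Real.exp_pos _)
  have h5 : max (-b k t) 0 ^ 2 ≤ 0 :=
    (Finset.single_le_sum (f := fun k => max (-b k t) 0 ^ 2) (fun k _ => sq_nonneg _)
      (Finset.mem_univ k)).trans h4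
  have h6 : max (-b k t) 0 = 0 :=
    (pow_eq_zero_iff two_ne_zero).1 (le_antisymm h5 (sq_nonneg _))
  have := le_max_left (-b k t) 0
  linarith

end ODE

/-! ### The coupling force in the rotating frame and its mean -/

section Kick

open Complex ComplexConjugate

/-- The direction, in the rotating frame, in which the coupling acts at phase `θ`. -/
noncomputable def phaseDir (θ : ℝ) : ℂ := I * exp (θ * I)

/-- The force exerted at phase `θ` through the coupling `φ` by a relative position `y`. -/
noncomputable def kick (φ : ℝ → ℝ) (θ : ℝ) (y : ℂ) : ℂ :=
  (φ (conj (phaseDir θ) * y).re : ℂ) * phaseDir θ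

/-- The mean of `kick` over one turn. -/
noncomputable def kickMean (φ : ℝ → ℝ) (y : ℂ) : ℂ :=
  (2 * Real.pi)⁻¹ • ∫ θ in (0 : ℝ)..(2 * Real.pi), kick φ θ y

theorem norm_phaseDir (θ : ℝ) : ‖phaseDir θ‖ = 1 := by
  simp [phaseDir, norm_exp_ofReal_mul_I]

theorem continuous_phaseDir : Continuous phaseDir := by unfold phaseDir; fun_prop

theorem phaseDir_eq (θ : ℝ) : phaseDir θ = ⟨-Real.sin θ, Real.cos θ⟩ := by
  apply Complex.ext <;> simp [phaseDir, exp_ofReal_mul_I_re, exp_ofReal_mul_I_im]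

theorem phaseDir_add (θ α : ℝ) : phaseDir (θ + α) = exp (α * I) * phaseDir θ := by
  simp only [phaseDir, ofReal_add, add_mul, exp_add]; ring

theorem abs_re_phaseDir_le (θ : ℝ) (y : ℂ) : |(conj (phaseDir θ) * y).re| ≤ ‖y‖ := by
  refine (abs_re_le_norm _).trans ?_
  simp [norm_phaseDir]

theorem phaseDir_periodic : Function.Periodic phaseDir (2 * Real.pi) := fun θ => by
  simp [phaseDir_eq]

theorem kick_periodic (φ : ℝ → ℝ) (y : ℂ) :
    Function.Periodic (fun θ => kick φ θ y) (2 * Real.pi) := fun θ => by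
  simp only [kick, phaseDir_periodic θ]

theorem kick_zero_right {φ : ℝ → ℝ} (h0 : φ 0 = 0) (θ : ℝ) : kick φ θ 0 = 0 := by
  simp [kick, h0]

theorem continuous_kick {φ : ℝ → ℝ} (hφ : Continuous φ) (y : ℂ) :
    Continuous fun θ => kick φ θ y := by
  unfold kick
  have := continuous_phaseDir
  have h2 : Continuous fun θ => conj (phaseDir θ) := continuous_conj.comp this
  fun_prop

theorem norm_kick_le {φ : ℝ → ℝ} {B : ℝ} (hB : ∀ s, |φ s| ≤ B) (θ : ℝ) (y : ℂ) :
    ‖kick φ θ y‖ ≤ B := by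
  simpa [kick, norm_phaseDir] using hB _

theorem lipschitzWith_kick {φ : ℝ → ℝ} {K : ℝ≥0} (hφ : LipschitzWith K φ) (θ : ℝ) :
    LipschitzWith K (kick φ θ) := by
  refine LipschitzWith.of_dist_le_mul fun y z => ?_
  rw [dist_eq_norm, dist_eq_norm, kick, kick, ← sub_mul, norm_mul, norm_phaseDir, mul_one,
    ← ofReal_sub, norm_real]
  refine (hφ.norm_sub_le _ _).trans ?_
  gcongr
  rw [← sub_re, ← mul_sub]
  exact abs_re_phaseDir_le θ _

theorem norm_kickMean_le {φ : ℝ → ℝ} {B : ℝ} (hB : ∀ s, |φ s| ≤ B) (y : ℂ) :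
    ‖kickMean φ y‖ ≤ B := by
  have hpi := Real.pi_pos
  rw [kickMean, norm_smul]
  have := intervalIntegral.norm_integral_le_of_norm_le_const (a := 0) (b := 2 * Real.pi)
    (f := fun θ => kick φ θ y) (C := B) fun θ _ => norm_kick_le hB θ y
  rw [sub_zero, abs_of_pos (by positivity)] at this
  rw [Real.norm_of_nonneg (by positivity), inv_mul_le_iff₀ (by positivity)]
  linarith

theorem lipschitzWith_kickMean {φ : ℝ → ℝ} {K : ℝ≥0} (hφ : LipschitzWith K φ) :
    LipschitzWith K (kickMean φ) := by
  have hpi := Real.pi_pos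
  refine LipschitzWith.of_dist_le_mul fun y z => ?_
  rw [dist_eq_norm, dist_eq_norm, kickMean, kickMean, ← smul_sub, ← intervalIntegral.integral_sub
    ((continuous_kick hφ.continuous y).intervalIntegrable _ _)
    ((continuous_kick hφ.continuous z).intervalIntegrable _ _), norm_smul]
  have := intervalIntegral.norm_integral_le_of_norm_le_const (a := 0) (b := 2 * Real.pi)
    (f := fun θ => kick φ θ y - kick φ θ z) (C := K * ‖y - z‖)
    fun θ _ => (lipschitzWith_kick hφ θ).norm_sub_le _ _
  rw [sub_zero, abs_of_pos (by positivity)] at this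
  rw [Real.norm_of_nonneg (by positivity), inv_mul_le_iff₀ (by positivity)]
  linarith

/-- Integral of a rapidly rotating kick over one period. -/
theorem integral_kick_mul (φ : ℝ → ℝ) (y : ℂ) {ω : ℝ} (hω : 0 < ω) (a : ℝ) :
    ∫ s in a..(a + 2 * Real.pi / ω), kick φ (ω * s) y = (2 * Real.pi / ω) • kickMean φ y := by
  have hpi := Real.pi_pos
  rw [intervalIntegral.integral_comp_mul_left (fun θ => kick φ θ y) hω.ne', mul_add,
    mul_div_cancel₀ _ hω.ne', (kick_periodic φ y).intervalIntegral_add_eq (ω * a) 0, zero_add,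
    kickMean, smul_smul]
  congr 1
  field_simp

/-- Shifting the phase by `α` rotates `phaseDir`, and a shift does not change the integral over a
full period. This reduces the mean force to positive real `y`. -/
theorem kickMean_exp_mul (φ : ℝ → ℝ) (α : ℝ) (y : ℂ) :
    kickMean φ (exp (α * I) * y) = exp (α * I) * kickMean φ y := by
  have hk : ∀ θ, kick φ (θ + α) (exp (α * I) * y) = exp (α * I) * kick φ θ y := by
    intro θ
    have h1 : conj (exp (α * I)) * exp (α * I) = 1 := by
      rw [conj_mul', norm_exp_ofReal_mul_I]; simp
    have h2 : conj (phaseDir (θ + α)) * (exp (α * I) * y) = conj (phaseDir θ) * y := by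
      rw [phaseDir_add, map_mul]
      linear_combination (conj (phaseDir θ) * y) * h1
    rw [kick, kick, h2, phaseDir_add]; ring
  have h3 := (kick_periodic φ (exp (α * I) * y)).intervalIntegral_add_eq 0 α
  have h4 := intervalIntegral.integral_comp_add_right (a := 0) (b := 2 * Real.pi)
    (fun θ => kick φ θ (exp (α * I) * y)) α
  rw [zero_add] at h3 h4
  rw [kickMean, kickMean, h3, add_comm α, ← h4]
  simp only [hk]
  rw [intervalIntegral.integral_const_mul, mul_smul_comm]

/-- The reflection `θ ↦ π - θ` fixes the sine and flips the cosine, so the component orthogonal to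
the real axis integrates to zero. -/
theorem kickMean_ofReal {φ : ℝ → ℝ} (hφ : Continuous φ) (r : ℝ) :
    kickMean φ r = (((2 * Real.pi)⁻¹ *
      ∫ θ in (0 : ℝ)..(2 * Real.pi), φ (-Real.sin θ * r) * -Real.sin θ : ℝ) : ℂ) := by
  have hk : ∀ θ, kick φ θ r =
      ((φ (-Real.sin θ * r) * -Real.sin θ : ℝ) : ℂ) +
        ((φ (-Real.sin θ * r) * Real.cos θ : ℝ) : ℂ) * I := by
    intro θ
    rw [kick, phaseDir_eq]
    apply Complex.ext <;> simp [-ofReal_sin, -ofReal_cos]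
  have hodd : ∫ θ in (0 : ℝ)..(2 * Real.pi), φ (-Real.sin θ * r) * Real.cos θ = 0 := by
    set f : ℝ → ℝ := fun θ => φ (-Real.sin θ * r) * Real.cos θ with hf
    have hper : Function.Periodic f (2 * Real.pi) := fun θ => by simp [hf]
    have h1 := intervalIntegral.integral_comp_sub_left (a := 0) (b := 2 * Real.pi) f Real.pi
    have h2 : ∀ θ, f (Real.pi - θ) = -f θ := fun θ => by simp [hf]
    have h3 := hper.intervalIntegral_add_eq (Real.pi - 2 * Real.pi) 0
    rw [sub_add_cancel, zero_add] at h3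
    simp only [h2, intervalIntegral.integral_neg, sub_zero] at h1
    rw [h3] at h1
    change ∫ θ in (0 : ℝ)..(2 * Real.pi), f θ = 0
    linarith
  rw [kickMean]
  simp only [hk]
  rw [intervalIntegral.integral_add, intervalIntegral.integral_mul_const,
    intervalIntegral.integral_ofReal, intervalIntegral.integral_ofReal, hodd]
  · simp
  · exact Continuous.intervalIntegrable (by fun_prop) _ _
  · exact Continuous.intervalIntegrable (by fun_prop) _ _

/-- The mean force is a nonnegative multiple of the relative position. -/
theorem exists_kickMean_eq {φ : ℝ → ℝ} {K : ℝ≥0} (hφ : LipschitzWith K φ) (h0 : φ 0 = 0)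
    (hs : ∀ s, 0 ≤ s * φ s) (y : ℂ) :
    ∃ w : ℝ, 0 ≤ w ∧ w ≤ K ∧ kickMean φ y = w * y ∧
      (y ≠ 0 → (∀ s, s ≠ 0 → φ s ≠ 0) → 0 < w) := by
  have hpi := Real.pi_pos
  have hz : kickMean φ 0 = 0 := by simp [kickMean, kick_zero_right h0]
  rcases eq_or_ne y 0 with rfl | hy
  · exact ⟨0, le_rfl, K.2, by simp [hz], fun h => absurd rfl h⟩
  have hr : 0 < ‖y‖ := norm_pos_iff.2 hy
  have hpol : y = exp (arg y * I) * ‖y‖ := by rw [mul_comm]; exact (norm_mul_exp_arg_mul_I y).symm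
  set r := ‖y‖
  set J : ℝ := ∫ θ in (0 : ℝ)..(2 * Real.pi), φ (-Real.sin θ * r) * -Real.sin θ
  have heq : kickMean φ y = (((2 * Real.pi)⁻¹ * J / r : ℝ) : ℂ) * y := by
    have hr' : (r : ℂ) ≠ 0 := by exact_mod_cast hr.ne'
    conv_lhs => rw [hpol]
    rw [kickMean_exp_mul, show kickMean φ r = (((2 * Real.pi)⁻¹ * J : ℝ) : ℂ) from
      kickMean_ofReal hφ.continuous r]
    clear_value J
    conv_rhs => rw [hpol]
    push_cast
    field_simp
  have hnn : ∀ θ, 0 ≤ φ (-Real.sin θ * r) * -Real.sin θ := fun θ => by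
    have h1 := hs (-Real.sin θ * r)
    have h2 : 0 ≤ r * (φ (-Real.sin θ * r) * -Real.sin θ) := by linarith
    exact nonneg_of_mul_nonneg_right h2 hr
  have hJ : 0 ≤ J := intervalIntegral.integral_nonneg (by positivity) fun θ _ => hnn θ
  have hw : 0 ≤ (2 * Real.pi)⁻¹ * J / r := by positivity
  refine ⟨(2 * Real.pi)⁻¹ * J / r, hw, ?_, heq, fun _ hne => ?_⟩
  -- `kickMean φ` is `K`-Lipschitz and vanishes at `0`, which bounds the multiplier by `K`.
  · have h1 := (lipschitzWith_kickMean hφ).norm_sub_le y 0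
    rw [hz, sub_zero, sub_zero, heq, norm_mul, norm_real, Real.norm_of_nonneg hw] at h1
    exact le_of_mul_le_mul_right h1 hr
  · have : 0 < J := by
      have hφc := hφ.continuous
      -- The integrand is continuous and nonnegative, so nonvanishing at the single phase `π / 2`,
      -- where the sine is `1`, suffices.
      refine intervalIntegral.integral_pos (by positivity) (Continuous.continuousOn (by fun_prop))
        (fun θ _ => hnn θ) ⟨Real.pi / 2, ⟨by positivity, by linarith⟩, ?_⟩
      refine lt_of_le_of_ne (hnn _) (Ne.symm (mul_ne_zero (hne _ ?_) ?_)) <;>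
      simp [hr.ne']
    positivity

end Kick

/-! ### Scalar consensus with time-varying weights -/

section Consensus

open Set

variable {ι : Type*} [Fintype ι] {a T K : ℝ} {b : ι → ℝ → ℝ} {w : ι → ι → ℝ → ℝ}

/-- Where `b i < 0`, each term `w (b j - b i)` is at least `w * b j`, hence at least `-K` times the
negative part of `b j`: the system is cooperative. -/
theorem consensus_nonneg (hK : 0 ≤ K)
    (hb : ∀ i, ∀ t ∈ Icc a T, HasDerivWithinAt (b i) (∑ j, w i j t * (b j t - b i t)) (Icc a T) t)
    (hw0 : ∀ i j t, 0 ≤ w i j t) (hwK : ∀ i j t, w i j t ≤ K) (h0 : ∀ i, 0 ≤ b i a) :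
    ∀ i, ∀ t ∈ Icc a T, 0 ≤ b i t := by
  refine nonneg_of_cooperative hK hb (fun i t _ hi => ?_) h0
  rw [Finset.mul_sum]
  refine Finset.sum_le_sum fun j _ => ?_
  have h1 := le_max_left (-b j t) 0
  have h2 := le_max_right (-b j t) 0
  nlinarith [mul_le_mul_of_nonneg_right (hwK i j t) h2, mul_le_mul_of_nonneg_left h1 (hw0 i j t),
    mul_nonneg (hw0 i j t) (neg_nonneg.2 hi.le)]

/-- Node `i` decays at rate at most `C = card ι * K`, so `exp (C * t) * b i t` is nondecreasing. -/
theorem consensus_pos_of_pos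
    (hb : ∀ i, ∀ t ∈ Icc a T, HasDerivWithinAt (b i) (∑ j, w i j t * (b j t - b i t)) (Icc a T) t)
    (hw0 : ∀ i j t, 0 ≤ w i j t) (hwK : ∀ i j t, w i j t ≤ K)
    (hnn : ∀ i, ∀ t ∈ Icc a T, 0 ≤ b i t) {i : ι} {s t : ℝ} (hs : s ∈ Icc a T)
    (ht : t ∈ Icc a T) (hst : s ≤ t) (hpos : 0 < b i s) : 0 < b i t := by
  set C : ℝ := Fintype.card ι * K
  have hmono : MonotoneOn (fun t => Real.exp (C * t) * b i t) (Icc a T) := by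
    have hd : ∀ t ∈ Icc a T, HasDerivWithinAt (fun t => Real.exp (C * t) * b i t)
        (Real.exp (C * t) * C * b i t +
          Real.exp (C * t) * ∑ j, w i j t * (b j t - b i t)) (Icc a T) t := by
      intro t ht
      refine HasDerivWithinAt.mul (HasDerivAt.hasDerivWithinAt ?_) (hb i t ht)
      simpa using ((hasDerivAt_id t).const_mul C).exp
    refine monotoneOn_of_hasDerivWithinAt_nonneg (convex_Icc a T)
      (fun t ht => (hd t ht).continuousWithinAt)
      (fun t ht => (hd t (interior_subset ht)).mono interior_subset) (fun t ht => ?_)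
    have ht := interior_subset ht
    have h1 : -(C * b i t) ≤ ∑ j, w i j t * (b j t - b i t) := by
      calc -(C * b i t) = ∑ _j : ι, -(K * b i t) := by simp [C]; ring
        _ ≤ _ := Finset.sum_le_sum fun j _ => by
          nlinarith [mul_nonneg (hw0 i j t) (hnn j t ht),
            mul_le_mul_of_nonneg_right (hwK i j t) (hnn i t ht)]
    nlinarith [Real.exp_pos (C * t)]
  have h := hmono hs ht hst
  exact pos_of_mul_pos_right (lt_of_lt_of_le (by positivity) h) (Real.exp_pos _).le

/-- If a node reachable from everywhere is strictly above the lower bound, then so is every node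
at all later times. -/
theorem consensus_pos {adj : ι → ι → Prop} {l : ι}
    (hconn : ∀ i, i ≠ l → Relation.ReflTransGen adj i l)
    (hb : ∀ i, ∀ t ∈ Icc a T, HasDerivWithinAt (b i) (∑ j, w i j t * (b j t - b i t)) (Icc a T) t)
    (hw0 : ∀ i j t, 0 ≤ w i j t) (hwK : ∀ i j t, w i j t ≤ K)
    (hadj : ∀ i j t, adj i j → b i t ≠ b j t → 0 < w i j t)
    (hnn : ∀ i, ∀ t ∈ Icc a T, 0 ≤ b i t) (hl : 0 < b l a) (i : ι) :
    ∀ t ∈ Ioc a T, 0 < b i t := by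
  have hreach : Relation.ReflTransGen adj i l := by
    by_cases h : i = l
    · rw [h]
    · exact hconn i h
  induction hreach using Relation.ReflTransGen.head_induction_on with
  | refl =>
    intro t ht
    exact consensus_pos_of_pos hb hw0 hwK hnn ⟨le_rfl, ht.1.le.trans ht.2⟩
      (Ioc_subset_Icc_self ht) ht.1.le hl
  | @head i j hij _ ih =>
    intro t ht
    by_contra hneg
    -- Positivity persists, so a zero at time `t` forces `b i` to vanish on all of `[a, t]`. Its
    -- derivative at the midpoint is then zero, although the already positive neighbour `j` pulls it
    -- upwards through a positive weight.
    have hzero : ∀ s ∈ Icc a t, b i s = 0 := by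
      intro s hs
      have hs' : s ∈ Icc a T := ⟨hs.1, hs.2.trans ht.2⟩
      by_contra hne
      exact hneg (consensus_pos_of_pos hb hw0 hwK hnn hs' (Ioc_subset_Icc_self ht) hs.2
        (lt_of_le_of_ne (hnn i s hs') (Ne.symm hne)))
    have haT := ht.1
    set s := (a + t) / 2
    have hs : s ∈ Ioo a t := ⟨by simp only [s]; linarith, by simp only [s]; linarith⟩
    have hsT : s ∈ Ioc a T := ⟨hs.1, hs.2.le.trans ht.2⟩
    have hd := (hb i s (Ioc_subset_Icc_self hsT)).hasDerivAt
      (Icc_mem_nhds hs.1 (hs.2.trans_le ht.2))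
    have hd0 : HasDerivAt (b i) 0 s := by
      refine (hasDerivAt_const s (0 : ℝ)).congr_of_eventuallyEq ?_
      filter_upwards [Icc_mem_nhds hs.1 hs.2] with r hr using hzero r hr
    have h0 := hd.unique hd0
    have hbs := hzero s (Ioo_subset_Icc_self hs)
    have hj := ih s hsT
    simp only [hbs, sub_zero] at h0
    have h1 := (Finset.sum_eq_zero_iff_of_nonneg
      fun k _ => mul_nonneg (hw0 i k s) (hnn k s (Ioc_subset_Icc_self hsT))).1 h0 j
      (Finset.mem_univ j)
    have h2 := hadj i j s hij (by rw [hbs]; exact hj.ne)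
    exact (mul_pos h2 hj).ne' h1

end Consensus

/-! ### Rotating and averaged fields; strict decay of the averaged spread -/

section Fields

open Set ComplexConjugate

variable {m : ℕ}

/-- The array of coupled oscillators in the rotating frame, at phase `θ`. -/
noncomputable def rotField (g : Fin m → Fin m → ℝ → ℝ) (θ : ℝ) (x : Fin m → ℂ) : Fin m → ℂ :=
  fun i => ∑ j, kick (g i j) θ (x j - x i)

/-- The average of `rotField` over the phase. -/
noncomputable def avgField (g : Fin m → Fin m → ℝ → ℝ) (x : Fin m → ℂ) : Fin m → ℂ :=
  fun i => ∑ j, kickMean (g i j) (x j - x i)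

/-- Globally Lipschitz, bounded, sign-preserving coupling functions, definite along edges. -/
structure IsTameCoupling (adj : Fin m → Fin m → Prop) (g : Fin m → Fin m → ℝ → ℝ) (K : ℝ≥0)
    (B : ℝ) : Prop where
  lipschitz : ∀ i j, LipschitzWith K (g i j)
  bounded : ∀ i j s, |g i j s| ≤ B
  map_zero : ∀ i j, g i j 0 = 0
  sign : ∀ i j s, 0 ≤ s * g i j s
  edge : ∀ i j, adj i j → ∀ s, s ≠ 0 → g i j s ≠ 0

variable {adj : Fin m → Fin m → Prop} {g : Fin m → Fin m → ℝ → ℝ} {K : ℝ≥0} {B : ℝ}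

theorem norm_sum_fin_le {f : Fin m → ℂ} {C : ℝ} (h : ∀ j, ‖f j‖ ≤ C) : ‖∑ j, f j‖ ≤ m * C := by
  simpa using norm_sum_le_of_le Finset.univ fun j _ => h j

theorem norm_sub_sub_sub_le (x y : Fin m → ℂ) (i j : Fin m) :
    ‖x j - x i - (y j - y i)‖ ≤ 2 * ‖x - y‖ := by
  have : x j - x i - (y j - y i) = (x - y) j - (x - y) i := by simp; ring
  rw [this]
  linarith [norm_sub_le ((x - y) j) ((x - y) i), norm_le_pi_norm (x - y) i,
    norm_le_pi_norm (x - y) j]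

theorem lipschitzWith_sum_differences {f : Fin m → Fin m → ℂ → ℂ}
    (hf : ∀ i j, LipschitzWith K (f i j)) :
    LipschitzWith (m * (K * 2)) fun (x : Fin m → ℂ) i => ∑ j, f i j (x j - x i) := by
  refine LipschitzWith.of_dist_le_mul fun x y => ?_
  rw [dist_eq_norm, dist_eq_norm]
  refine (pi_norm_le_iff_of_nonneg (by positivity)).2 fun i => ?_
  simp only [Pi.sub_apply, ← Finset.sum_sub_distrib]
  refine (norm_sum_fin_le (C := K * (2 * ‖x - y‖)) fun j => ?_).trans (le_of_eq ?_)
  · exact ((hf i j).norm_sub_le _ _).trans (by gcongr; exact norm_sub_sub_sub_le x y i j)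
  · push_cast; ring

namespace IsTameCoupling

theorem bound_nonneg (hg : IsTameCoupling adj g K B) (i : Fin m) : 0 ≤ B :=
  (abs_nonneg _).trans (hg.bounded i i 0)

theorem lipschitzWith_rotField (hg : IsTameCoupling adj g K B) (θ : ℝ) :
    LipschitzWith (m * (K * 2)) (rotField g θ) :=
  lipschitzWith_sum_differences fun i j => lipschitzWith_kick (hg.lipschitz i j) θ

theorem lipschitzWith_avgField (hg : IsTameCoupling adj g K B) :
    LipschitzWith (m * (K * 2)) (avgField g) :=
  lipschitzWith_sum_differences fun i j => lipschitzWith_kickMean (hg.lipschitz i j)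

theorem continuous_rotField (hg : IsTameCoupling adj g K B) (x : Fin m → ℂ) :
    Continuous fun θ => rotField g θ x :=
  continuous_pi fun i => continuous_finsetSum _ fun j _ =>
    continuous_kick (hg.lipschitz i j).continuous _

theorem norm_rotField_le (hg : IsTameCoupling adj g K B) (hB : 0 ≤ B) (θ : ℝ) (x : Fin m → ℂ) :
    ‖rotField g θ x‖ ≤ m * B :=
  (pi_norm_le_iff_of_nonneg (by positivity)).2 fun i =>
    norm_sum_fin_le fun j => norm_kick_le (hg.bounded i j) _ _

theorem norm_avgField_le (hg : IsTameCoupling adj g K B) (hB : 0 ≤ B) (x : Fin m → ℂ) :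
    ‖avgField g x‖ ≤ m * B :=
  (pi_norm_le_iff_of_nonneg (by positivity)).2 fun i =>
    norm_sum_fin_le fun j => norm_kickMean_le (hg.bounded i j) _

theorem integral_rotField (hg : IsTameCoupling adj g K B) {ω : ℝ} (hω : 0 < ω) (a : ℝ)
    (x : Fin m → ℂ) :
    ∫ s in a..(a + 2 * Real.pi / ω), rotField g (ω * s) x =
      (2 * Real.pi / ω) • avgField g x := by
  have hc : Continuous fun s => rotField g (ω * s) x :=
    (hg.continuous_rotField x).comp (continuous_const.mul continuous_id)
  funext i
  have h := (ContinuousLinearMap.proj (R := ℝ) (φ := fun _ : Fin m => ℂ) i).intervalIntegral_comp_comm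
    (μ := MeasureTheory.volume) (hc.intervalIntegrable a (a + 2 * Real.pi / ω))
  simp only [ContinuousLinearMap.proj_apply] at h
  rw [← h, Pi.smul_apply, avgField, Finset.smul_sum]
  simp only [rotField]
  have hint : ∀ j, IntervalIntegrable (fun s => kick (g i j) (ω * s) (x j - x i))
      MeasureTheory.volume a (a + 2 * Real.pi / ω) := fun j => Continuous.intervalIntegrable
    ((continuous_kick (hg.lipschitz i j).continuous _).comp (continuous_const.mul continuous_id)) _ _
  rw [intervalIntegral.integral_finsetSum fun j _ => hint j]
  exact Finset.sum_congr rfl fun j _ => integral_kick_mul _ _ hω a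

end IsTameCoupling

/-- The largest distance between two nodes. -/
noncomputable def spread (x : Fin m → ℂ) : ℝ := ‖fun p : Fin m × Fin m => x p.1 - x p.2‖

theorem spread_nonneg (x : Fin m → ℂ) : 0 ≤ spread x := norm_nonneg _

theorem norm_sub_le_spread (x : Fin m → ℂ) (i j : Fin m) : ‖x i - x j‖ ≤ spread x :=
  norm_le_pi_norm (fun p : Fin m × Fin m => x p.1 - x p.2) (i, j)

theorem spread_le_iff {x : Fin m → ℂ} {r : ℝ} (hr : 0 ≤ r) :
    spread x ≤ r ↔ ∀ i j, ‖x i - x j‖ ≤ r := by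
  rw [spread, pi_norm_le_iff_of_nonneg hr]
  exact ⟨fun h i j => h (i, j), fun h p => h p.1 p.2⟩

theorem exists_spread_eq (x : Fin m → ℂ) (l : Fin m) : ∃ i j, spread x = ‖x i - x j‖ := by
  have : Nonempty (Fin m × Fin m) := ⟨(l, l)⟩
  obtain ⟨p, hp⟩ := Finite.exists_max fun p : Fin m × Fin m => ‖x p.1 - x p.2‖
  exact ⟨p.1, p.2, le_antisymm ((spread_le_iff (norm_nonneg _)).2 fun i j => hp (i, j))
    (norm_sub_le_spread x _ _)⟩

theorem spread_sub_le (x y : Fin m → ℂ) : spread x ≤ spread y + 2 * ‖x - y‖ := by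
  refine (spread_le_iff (add_nonneg (spread_nonneg y) (by positivity))).2 fun i j => ?_
  have h1 := norm_sub_sub_sub_le x y j i
  have h2 := norm_sub_le_spread y i j
  have h3 := norm_le_norm_add_norm_sub (y i - y j) (x i - x j)
  rw [norm_sub_rev (y i - y j)] at h3
  linarith

theorem continuous_spread : Continuous (spread : (Fin m → ℂ) → ℝ) := by
  unfold spread; fun_prop

theorem spread_sub_const (x : Fin m → ℂ) (c : ℂ) : (spread fun i => x i - c) = spread x := by
  simp [spread]

/-- Along averaged solutions no linear functional rises above its initial maximum; nodes leave that
maximum at once unless the root attains it. -/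
theorem avgField_upper_bound (hg : IsTameCoupling adj g K B) {l : Fin m}
    (hconn : ∀ i, i ≠ l → Relation.ReflTransGen adj i l) {T : ℝ} {y : ℝ → Fin m → ℂ}
    (hy : IsIntegralCurveOn y (fun _ => avgField g) (Icc 0 T)) (u : ℂ) {M : ℝ}
    (hM : ∀ i, (conj u * y 0 i).re ≤ M) :
    (∀ i, ∀ t ∈ Icc 0 T, (conj u * y t i).re ≤ M) ∧
    ((conj u * y 0 l).re < M → ∀ i, ∀ t ∈ Ioc 0 T, (conj u * y t i).re < M) := by
  choose w hw0 hwK hweq hwpos using fun i j t =>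
    exists_kickMean_eq (hg.lipschitz i j) (hg.map_zero i j) (hg.sign i j) (y t j - y t i)
  -- Because the multipliers `w` are real, they commute with the functional, so the gaps below `M`
  -- obey scalar consensus with the same weights.
  set b : Fin m → ℝ → ℝ := fun i t => M - (conj u * y t i).re with hbdef
  have hb : ∀ i, ∀ t ∈ Icc 0 T,
      HasDerivWithinAt (b i) (∑ j, w i j t * (b j t - b i t)) (Icc 0 T) t := by
    intro i t ht
    have h1 := (hasDerivWithinAt_pi.1 (hy t ht)) i
    have h2 := (Complex.reCLM.hasFDerivAt.comp_hasDerivWithinAt t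
      (h1.const_mul (conj u))).const_sub M
    refine h2.congr_deriv ?_
    simp only [avgField, hweq, Complex.reCLM_apply, Finset.mul_sum, Complex.re_sum,
      ← Finset.sum_neg_distrib, hbdef]
    refine Finset.sum_congr rfl fun j _ => ?_
    rw [mul_left_comm, Complex.re_ofReal_mul, mul_sub, Complex.sub_re]; ring
  have hnn := consensus_nonneg K.2 hb hw0 hwK fun i => sub_nonneg.2 (hM i)
  refine ⟨fun i t ht => sub_nonneg.1 (hnn i t ht), fun hl i t ht => sub_pos.1 ?_⟩
  refine consensus_pos hconn hb hw0 hwK (fun i j t hij hne => ?_) hnn (sub_pos.2 hl) i t ht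
  refine hwpos i j t (fun h => hne ?_) (hg.edge i j hij)
  simp only [hbdef, sub_eq_zero.1 h]

theorem re_conj_mul_le (u v : ℂ) : (conj u * v).re ≤ ‖u‖ * ‖v‖ := by
  refine (Complex.re_le_norm _).trans ?_
  simp

/-- Test with the direction `u` joining two nodes at maximal distance at time `t`. Then `‖u‖ ^ 2` is
at most the initial range `M - N` of the functional, which is at most `‖u‖ * spread (y 0)`. The
first bound is strict if the root misses the initial maximum or minimum; if it attains both, then `M
= N` and `u = 0`. -/
theorem avgField_spread (hg : IsTameCoupling adj g K B) {l : Fin m}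
    (hconn : ∀ i, i ≠ l → Relation.ReflTransGen adj i l) {T t : ℝ} {y : ℝ → Fin m → ℂ}
    (hy : IsIntegralCurveOn y (fun _ => avgField g) (Icc 0 T)) (ht : t ∈ Icc 0 T) :
    spread (y t) ≤ spread (y 0) ∧ (0 < t → 0 < spread (y 0) → spread (y t) < spread (y 0)) := by
  obtain ⟨i, j, hij⟩ := exists_spread_eq (y t) l
  set u := y t i - y t j
  have hne : Nonempty (Fin m) := ⟨l⟩
  obtain ⟨p, hp⟩ := Finite.exists_max fun k => (conj u * y 0 k).re
  obtain ⟨q, hq⟩ := Finite.exists_min fun k => (conj u * y 0 k).re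
  set M := (conj u * y 0 p).re
  set N := (conj u * y 0 q).re
  obtain ⟨hup, hups⟩ := avgField_upper_bound hg hconn hy u hp
  obtain ⟨hlo, hlos⟩ := avgField_upper_bound hg hconn hy (-u) (M := -N) fun k => by
    simpa using hq k
  simp only [map_neg, neg_mul, Complex.neg_re, neg_le_neg_iff, neg_lt_neg_iff] at hlo hlos
  have hsq : ‖u‖ * ‖u‖ = (conj u * y t i).re - (conj u * y t j).re := by
    rw [← Complex.sub_re, ← mul_sub, Complex.conj_mul']
    norm_cast
    rw [sq]
  have hMN : M - N ≤ ‖u‖ * spread (y 0) := by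
    have h := re_conj_mul_le u (y 0 p - y 0 q)
    rw [mul_sub, Complex.sub_re] at h
    exact h.trans (by gcongr; exact norm_sub_le_spread _ _ _)
  have h1 := hup i t ht
  have h2 := hlo j t ht
  rw [hij]
  rcases (norm_nonneg u).eq_or_lt with h0 | h0
  · rw [← h0]
    exact ⟨spread_nonneg _, fun _ h => h⟩
  refine ⟨le_of_mul_le_mul_left (by linarith) h0, fun ht0 _ => ?_⟩
  refine lt_of_mul_lt_mul_left ?_ h0.le
  have ht' : t ∈ Ioc 0 T := ⟨ht0, ht.2⟩
  rcases (hp l).lt_or_eq with hl | hl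
  · linarith [hups hl i t ht']
  rcases (hq l).lt_or_eq with hl' | hl'
  · linarith [hlos hl' j t ht']
  · nlinarith [mul_pos h0 h0]

theorem avgField_sub_const (x : Fin m → ℂ) (c : ℂ) :
    (avgField g fun i => x i - c) = avgField g x := by
  funext i
  simp [avgField]

/-- The averaged spread decreases by a definite amount, uniformly over compact ranges. -/
theorem exists_spread_decrease (hg : IsTameCoupling adj g K B) {l : Fin m}
    (hconn : ∀ i, i ≠ l → Relation.ReflTransGen adj i l) {T c D : ℝ} (hT : 0 < T) (hc : 0 < c) :
    ∃ κ > 0, ∀ y : ℝ → Fin m → ℂ, IsIntegralCurveOn y (fun _ => avgField g) (Icc 0 T) →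
      c ≤ spread (y 0) → spread (y 0) ≤ D → spread (y T) ≤ spread (y 0) - κ := by
  have hB := hg.bound_nonneg l
  choose Φ hΦ0 hΦ using fun x₀ => exists_isIntegralCurveOn_Icc (f := fun _ => avgField g)
    (fun _ => hg.lipschitzWith_avgField) (fun _ => continuous_const)
    (fun _ => hg.norm_avgField_le hB) hT.le x₀
  have hTmem : T ∈ Icc 0 T := ⟨hT.le, le_rfl⟩
  have hΦc : Continuous fun x => Φ x T := by
    refine LipschitzWith.continuous (K := (Real.exp ((m * (K * 2) : ℝ≥0) * T)).toNNReal)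
      (LipschitzWith.of_dist_le_mul fun x y => ?_)
    have h := dist_le_of_trajectories_ODE (fun _ => hg.lipschitzWith_avgField)
      (hΦ x).continuousOn (fun t ht => (hΦ x).hasDerivWithinAt_Ici ht)
      (hΦ y).continuousOn (fun t ht => (hΦ y).hasDerivWithinAt_Ici ht) le_rfl T hTmem
    rw [hΦ0, hΦ0, sub_zero, mul_comm] at h
    rwa [Real.coe_toNNReal _ (Real.exp_pos _).le]
  -- Pinning the root at the origin removes the translations, along which configurations of bounded
  -- spread are not compact.
  set S : Set (Fin m → ℂ) := {x | x l = 0 ∧ c ≤ spread x ∧ spread x ≤ D}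
  have hS : IsCompact S := by
    refine Metric.isCompact_of_isClosed_isBounded ?_ ?_
    · exact (isClosed_eq (continuous_apply l) continuous_const).inter
        ((isClosed_le continuous_const continuous_spread).inter
          (isClosed_le continuous_spread continuous_const))
    · refine (Metric.isBounded_iff_subset_closedBall 0).2 ⟨D, fun x hx => ?_⟩
      rw [mem_closedBall_zero_iff]
      refine (pi_norm_le_iff_of_nonneg ((spread_nonneg x).trans hx.2.2)).2 fun i => ?_
      have := norm_sub_le_spread x i l
      rw [hx.1, sub_zero] at this
      exact this.trans hx.2.2
  obtain ⟨κ, hκ, hκS⟩ : ∃ κ > 0, ∀ x ∈ S, κ ≤ spread x - spread (Φ x T) := by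
    rcases S.eq_empty_or_nonempty with h | h
    · exact ⟨1, one_pos, by simp [h]⟩
    · obtain ⟨x, hx, hmin⟩ := hS.exists_isMinOn h
        ((continuous_spread.sub (continuous_spread.comp hΦc)).continuousOn)
      refine ⟨_, ?_, fun z hz => hmin hz⟩
      have := (avgField_spread hg hconn (hΦ x) hTmem).2 hT
      rw [hΦ0] at this
      exact sub_pos.2 (this (hc.trans_le hx.2.1))
  refine ⟨κ, hκ, fun y hy h1 h2 => ?_⟩
  -- Recentring at the initial root position keeps `y` a solution with the same spread and lets it
  -- start in `S`; uniqueness identifies it with `Φ`.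
  set z : ℝ → Fin m → ℂ := fun t i => y t i - y 0 l with hz
  have hzc : IsIntegralCurveOn z (fun _ => avgField g) (Icc 0 T) := fun t ht => by
    have := (hy t ht).sub_const fun _ => y 0 l
    simp only [hz, avgField_sub_const]
    exact this
  have heq := IsIntegralCurveOn.eqOn_Icc (fun _ => hg.lipschitzWith_avgField) (hΦ (z 0)) hzc
    (hΦ0 _) hTmem
  have hsp : ∀ t, spread (z t) = spread (y t) := fun t => spread_sub_const _ _
  have := hκS (z 0) ⟨by simp [hz], by rwa [hsp], by rwa [hsp]⟩
  rw [heq, hsp, hsp] at this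
  linarith

end Fields

/-! ### Transferring the decay to fast oscillation -/

section Practical

open Set
open scoped Pointwise

variable {m : ℕ} {adj : Fin m → Fin m → Prop} {g : Fin m → Fin m → ℝ → ℝ} {K : ℝ≥0} {B : ℝ}

/-- Over a block of `⌈ω⌉` periods the spread follows the averaged one up to a small error. -/
theorem spread_block (hg : IsTameCoupling adj g K B) {l : Fin m}
    (hconn : ∀ i, i ≠ l → Relation.ReflTransGen adj i l) {c D : ℝ} (hc : 0 < c) :
    ∃ κ > 0, ∀ η > 0, ∃ ω₀ > 0, ∀ ω, ω₀ ≤ ω → ∃ τ > 0, ∀ (a : ℝ) (x : ℝ → Fin m → ℂ),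
      IsIntegralCurveOn x (fun t => rotField g (ω * t)) (Icc a (a + τ)) → spread (x a) ≤ D →
      spread (x (a + τ)) ≤ max (spread (x a) - κ) c + η ∧
      ∀ t ∈ Icc a (a + τ), spread (x t) ≤ spread (x a) + η := by
  have hpi := Real.pi_pos
  have hB := hg.bound_nonneg l
  obtain ⟨κ, hκ, hdec⟩ := exists_spread_decrease hg hconn (T := 2 * Real.pi) (D := D)
    (by positivity) hc
  refine ⟨κ, hκ, fun η hη => ?_⟩
  set Kf : ℝ≥0 := m * (K * 2)
  set Bf : ℝ := m * B
  have hBf : 0 ≤ Bf := by positivity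
  -- `C * h` bounds the averaging error on a block, since `n * h ≤ 4π` for `ω ≥ 1`. The threshold on
  -- `ω` below makes twice this error plus twice the drift `Bf * h` within one period at most `η`.
  set C : ℝ := 2 * Kf * Bf * (4 * Real.pi) * Real.exp (Kf * (4 * Real.pi))
  have hC : 0 ≤ C := by positivity
  refine ⟨max 1 (2 * (C + Bf) * (2 * Real.pi) / η), by positivity, fun ω hω => ?_⟩
  have hω1 : 1 ≤ ω := (le_max_left _ _).trans hω
  have hω0 : 0 < ω := by linarith
  set h : ℝ := 2 * Real.pi / ω with hh
  have hh0 : 0 < h := by positivity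
  have hsmall : 2 * (C + Bf) * h ≤ η := by
    have := (le_max_right _ _).trans hω
    rw [div_le_iff₀ hη] at this
    rw [hh, ← mul_div_assoc, div_le_iff₀ hω0]
    linarith
  set n : ℕ := ⌈ω⌉₊
  have hωh : ω * h = 2 * Real.pi := by rw [hh]; field_simp
  have hn1 : 2 * Real.pi ≤ n * h := by
    rw [← hωh]; gcongr; exact Nat.le_ceil ω
  have hn2 : n * h ≤ 4 * Real.pi := by
    have h1 : (n : ℝ) ≤ 2 * ω := by linarith [(Nat.ceil_lt_add_one hω0.le).le]
    calc n * h ≤ 2 * ω * h := by gcongr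
      _ = _ := by rw [mul_assoc, hωh]; ring
  refine ⟨n * h, by linarith, fun a x hx hD => ?_⟩
  obtain ⟨y, hy0, hy⟩ := exists_isIntegralCurveOn_Icc (f := fun _ => avgField g)
    (fun _ => hg.lipschitzWith_avgField) (fun _ => continuous_const)
    (fun _ => hg.norm_avgField_le hB) (a := 0) (b := n * h) (by positivity) (x a)
  have hBx : ∀ t x, ‖rotField g (ω * t) x‖ ≤ Bf := fun t x => hg.norm_rotField_le hB _ _
  have herr : ∀ k ≤ n, ‖x (a + k * h) - y (k * h)‖ ≤ C * h := by
    intro k hk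
    have h1 := norm_sub_averaged_le (f := fun t => rotField g (ω * t)) (F := avgField g)
      (fun t => hg.lipschitzWith_rotField _)
      (fun x => (hg.continuous_rotField x).comp (continuous_const.mul continuous_id))
      hBx hg.lipschitzWith_avgField (hg.norm_avgField_le hB) hh0.le
      (fun a x => hg.integral_rotField hω0 a x) hx hy hy0.symm k hk
    have hkh : (k : ℝ) * h ≤ 4 * Real.pi := by
      refine le_trans ?_ hn2
      gcongr
    calc _ ≤ _ := h1
      _ = 2 * Kf * Bf * (k * h) * Real.exp (Kf * (k * h)) * h := by ring
      _ ≤ C * h := by simp only [C]; gcongr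
  have hyk : ∀ k ≤ n, spread (x (a + k * h)) ≤ spread (y (k * h)) + 2 * (C * h) := fun k hk => by
    linarith [spread_sub_le (x (a + k * h)) (y (k * h)), herr k hk]
  have hmono : ∀ t ∈ Icc 0 (n * h), spread (y t) ≤ spread (x a) := fun t ht => by
    rw [← hy0]; exact (avgField_spread hg hconn hy ht).1
  have hBh : 0 ≤ Bf * h := by positivity
  constructor
  · have h1 := hyk n le_rfl
    -- The guaranteed decrease refers to the fixed time `2π`; the rest of the block is covered by
    -- monotonicity of the averaged spread, restarted at `2π`.
    have h2 : spread (y (n * h)) ≤ spread (y (2 * Real.pi)) := by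
      have hz := (hy.mono (Icc_subset_Icc (by positivity : 0 ≤ 2 * Real.pi) le_rfl)).comp_add
        (2 * Real.pi)
      have hset : -(2 * Real.pi) +ᵥ Icc (2 * Real.pi) (n * h) = Icc 0 (n * h - 2 * Real.pi) := by
        ext t
        rw [mem_vadd_set_iff_neg_vadd_mem, neg_neg, vadd_eq_add, mem_Icc, mem_Icc]
        constructor <;> rintro ⟨h1, h2⟩ <;> constructor <;> linarith
      rw [hset] at hz
      have := (avgField_spread hg hconn hz (t := n * h - 2 * Real.pi)
        ⟨by linarith, le_rfl⟩).1
      simpa using this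
    rcases le_total (spread (x a)) c with hca | hca
    · have := hmono (n * h) ⟨by positivity, le_rfl⟩
      linarith [le_max_right (spread (x a) - κ) c]
    · have := hdec y (hy.mono (Icc_subset_Icc le_rfl hn1)) (by rwa [hy0]) (by rwa [hy0])
      rw [hy0] at this
      linarith [le_max_left (spread (x a) - κ) c]
  · intro t ht
    -- Between sampling times, compare with the last multiple of the period before `t`.
    set k : ℕ := ⌊(t - a) / h⌋₊
    have hta : 0 ≤ (t - a) / h := div_nonneg (by linarith [ht.1]) hh0.le
    have hk1 : (k : ℝ) * h ≤ t - a := (le_div_iff₀ hh0).1 (Nat.floor_le hta)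
    have hk2 : t - a < (k + 1) * h := (div_lt_iff₀ hh0).1 (Nat.lt_floor_add_one _)
    have hkn : k ≤ n := by
      have : (k : ℝ) ≤ n := le_of_mul_le_mul_right (hk1.trans (by linarith [ht.2])) hh0
      exact_mod_cast this
    have h1 := hx.norm_sub_le hBx (s := a + k * h) (t := t)
      (le_add_of_nonneg_right (by positivity)) (by linarith) ht.2
    have h2 : Bf * (t - (a + k * h)) ≤ Bf * h := by
      gcongr; linarith
    have h3 := hmono (k * h) ⟨by positivity, by gcongr⟩
    linarith [hyk k hkn, spread_sub_le (x t) (x (a + k * h))]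

/-- Practical stability of synchronization for tame couplings in the rotating frame. -/
theorem spread_practical (hg : IsTameCoupling adj g K B) {l : Fin m}
    (hconn : ∀ i, i ≠ l → Relation.ReflTransGen adj i l) {c D : ℝ} (hc : 0 < c) (hcD : c ≤ D) :
    ∃ ω₀ > 0, ∀ ω, ω₀ ≤ ω → ∃ τ > 0, ∃ T > 0, ∀ (N : ℕ) (a : ℝ) (x : ℝ → Fin m → ℂ),
      IsIntegralCurveOn x (fun t => rotField g (ω * t)) (Icc a (a + N * τ)) → spread (x a) ≤ D →
      ∀ t ∈ Icc a (a + N * τ), spread (x t) ≤ D + c ∧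
        (spread (x a) ≤ c / 2 → spread (x t) ≤ c) ∧ (a + T ≤ t → spread (x t) ≤ c) := by
  have hD0 : 0 < D := hc.trans_le hcD
  obtain ⟨κ, hκ, hblock⟩ := spread_block hg hconn (c := c / 4) (D := D) (by positivity)
  -- This error leaves a net decrease of `κ / 2` per block until the level `c / 4 + c / 4 = c / 2`,
  -- and an excess of at most `c / 4` inside a block.
  obtain ⟨ω₀, hω₀, hblock⟩ := hblock (min (κ / 2) (c / 4)) (by positivity)
  refine ⟨ω₀, hω₀, fun ω hω => ?_⟩
  obtain ⟨τ, hτ, hblock⟩ := hblock ω hω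
  -- `2 * D / κ` blocks of net decrease `κ / 2` use up `D`; the extra block accounts for `t` lying
  -- inside a block.
  refine ⟨τ, hτ, (2 * D / κ + 1) * τ, by positivity, fun N a x hx hD t ht => ?_⟩
  have hη1 := min_le_left (κ / 2) (c / 4)
  have hη2 := min_le_right (κ / 2) (c / 4)
  set d : ℝ := spread (x a)
  have hsub : ∀ k : ℕ, k + 1 ≤ N →
      IsIntegralCurveOn x (fun t => rotField g (ω * t)) (Icc (a + k * τ) (a + k * τ + τ)) := by
    intro k hk
    have hk' : ((k : ℝ) + 1) * τ ≤ N * τ := by gcongr; exact_mod_cast hk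
    exact hx.mono (Icc_subset_Icc (le_add_of_nonneg_right (by positivity)) (by linarith))
  have hle : ∀ k : ℕ, max (d - k * (κ / 2)) (c / 2) ≤ D := fun k =>
    max_le (by have : 0 ≤ k * (κ / 2) := by positivity
               linarith) (by linarith)
  have hiter : ∀ k : ℕ, k ≤ N → spread (x (a + k * τ)) ≤ max (d - k * (κ / 2)) (c / 2) := by
    intro k
    induction k with
    | zero => intro _; simp [d]
    | succ k ih =>
      intro hk
      have ih := ih (by omega)
      have h1 := (hblock _ x (hsub k hk) (ih.trans (hle k))).1
      have e : a + (k + 1 : ℕ) * τ = a + k * τ + τ := by push_cast; ring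
      rw [e]
      push_cast
      refine h1.trans ?_
      rcases max_cases (spread (x (a + k * τ)) - κ) (c / 4) with ⟨h2, _⟩ | ⟨h2, _⟩ <;> rw [h2]
      · rcases le_max_iff.1 ih with h3 | h3
        · exact le_max_of_le_left (by linarith)
        · exact le_max_of_le_right (by linarith)
      · exact le_max_of_le_right (by linarith)
  -- `k` counts the blocks completed by time `t`. The endpoint `a + N * τ` has no block after it and
  -- is handled by `hiter` directly.
  obtain ⟨k, hk, hkt⟩ : ∃ k : ℕ, spread (x t) ≤ max (d - k * (κ / 2)) (c / 2) + c / 4 ∧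
      t - a ≤ (k + 1) * τ := by
    rcases ht.2.eq_or_lt with h | h
    · exact ⟨N, by rw [h]; linarith [hiter N le_rfl], by rw [h]; linarith⟩
    · set k : ℕ := ⌊(t - a) / τ⌋₊
      have hta : 0 ≤ (t - a) / τ := div_nonneg (by linarith [ht.1]) hτ.le
      have hk1 : (k : ℝ) * τ ≤ t - a := (le_div_iff₀ hτ).1 (Nat.floor_le hta)
      have hk2 : t - a < (k + 1) * τ := (div_lt_iff₀ hτ).1 (Nat.lt_floor_add_one _)
      have hkN : k < N := by
        have : (k : ℝ) < N := lt_of_mul_lt_mul_right (hk1.trans_lt (by linarith)) hτ.le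
        exact_mod_cast this
      have hik := hiter k hkN.le
      have := (hblock _ x (hsub k hkN) (hik.trans (hle k))).2 t ⟨by linarith, by linarith⟩
      exact ⟨k, by linarith, hk2.le⟩
  have hknn : 0 ≤ k * (κ / 2) := by positivity
  refine ⟨by linarith [hle k], fun hd => ?_, fun hT => ?_⟩
  · have : max (d - k * (κ / 2)) (c / 2) ≤ c / 2 := max_le (by linarith) le_rfl
    linarith
  · have h1 : 2 * D / κ ≤ k := by
      have := le_of_mul_le_mul_right ((show (2 * D / κ + 1) * τ ≤ t - a by linarith).trans hkt) hτ
      linarith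
    rw [div_le_iff₀ hκ] at h1
    have : max (d - k * (κ / 2)) (c / 2) ≤ c / 2 := max_le (by linarith) le_rfl
    linarith

end Practical

/-! ### Passage to the rotating frame -/

section RotatingFrame

open Set Complex ComplexConjugate

variable {m : ℕ}

theorem hasDerivWithinAt_piLp {ι : Type*} [Fintype ι] {E : ι → Type*}
    [∀ i, NormedAddCommGroup (E i)] [∀ i, NormedSpace ℝ (E i)] {f : ℝ → PiLp 2 E} {f' : PiLp 2 E}
    {s : Set ℝ} {t : ℝ} :
    HasDerivWithinAt f f' s t ↔ ∀ i, HasDerivWithinAt (fun t => f t i) (f' i) s t := by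
  rw [hasDerivWithinAt_iff_hasFDerivWithinAt, hasFDerivWithinAt_piLp]
  refine forall_congr' fun i => ?_
  rw [hasDerivWithinAt_iff_hasFDerivWithinAt]
  have h : (PiLp.proj 2 E i).comp (ContinuousLinearMap.toSpanSingleton ℝ f') =
      ContinuousLinearMap.toSpanSingleton ℝ (f' i) := by
    apply ContinuousLinearMap.ext_ring
    simp
  rw [h]

theorem isIntegralCurveOn_arrayState {ξ : ℝ → ArrayState m} {f : ArrayState m → ArrayState m}
    {s : Set ℝ} :
    IsIntegralCurveOn ξ (fun _ v => f v) s ↔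
      ∀ t ∈ s, ∀ (i : Fin m) (c : Fin 2),
        HasDerivWithinAt (fun t => ξ t i c) (f (ξ t) i c) s t :=
  forall₂_congr fun _ _ =>
    hasDerivWithinAt_piLp.trans (forall_congr' fun _ => hasDerivWithinAt_piLp)

/-- The state of the array in the frame rotating with phase `θ`, in complex notation. -/
noncomputable def toRot (θ : ℝ) (ξ : ArrayState m) : Fin m → ℂ :=
  fun i => exp (θ * I) * ⟨ξ i 0, ξ i 1⟩

/-- The inverse of `toRot`. -/
noncomputable def ofRot (θ : ℝ) (x : Fin m → ℂ) : ArrayState m :=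
  WithLp.toLp 2 fun i => !₂[(conj (exp (θ * I)) * x i).re, (conj (exp (θ * I)) * x i).im]

theorem conj_exp_mul_exp (θ : ℝ) : conj (exp (θ * I)) * exp (θ * I) = 1 := by
  rw [conj_mul', norm_exp_ofReal_mul_I]; simp

theorem ofRot_toRot (θ : ℝ) (ξ : ArrayState m) : ofRot θ (toRot θ ξ) = ξ := by
  ext i c
  have h : conj (exp (θ * I)) * toRot θ ξ i = ⟨ξ i 0, ξ i 1⟩ := by
    rw [toRot, ← mul_assoc, conj_exp_mul_exp, one_mul]
  fin_cases c <;> simp only [ofRot, h] <;> rfl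

theorem toRot_ofRot (θ : ℝ) (x : Fin m → ℂ) : toRot θ (ofRot θ x) = x := by
  funext i
  have h : (⟨(ofRot θ x) i 0, (ofRot θ x) i 1⟩ : ℂ) = conj (exp (θ * I)) * x i := by
    apply Complex.ext <;> rfl
  rw [toRot, h, ← mul_assoc, mul_comm (exp _), conj_exp_mul_exp, one_mul]

/-- The factors combine to `conj (I e^{iθ}) e^{iθ} = -I`, and the real part of `-I (q + I p)` is
`p`. This is why `kick` represents the velocity coupling. -/
theorem re_phaseDir_toRot (θ : ℝ) (ξ : ArrayState m) (i j : Fin m) :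
    (conj (phaseDir θ) * (toRot θ ξ j - toRot θ ξ i)).re = ξ j 1 - ξ i 1 := by
  have h : conj (phaseDir θ) * (toRot θ ξ j - toRot θ ξ i) =
      -I * ((⟨ξ j 0, ξ j 1⟩ : ℂ) - ⟨ξ i 0, ξ i 1⟩) := by
    simp only [phaseDir, toRot, map_mul, conj_I]
    linear_combination (-I * ((⟨ξ j 0, ξ j 1⟩ : ℂ) - ⟨ξ i 0, ξ i 1⟩)) * conj_exp_mul_exp θ
  rw [h]; simp

theorem norm_toRot_sub (θ : ℝ) (ξ : ArrayState m) (i j : Fin m) :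
    ‖toRot θ ξ i - toRot θ ξ j‖ = ‖ξ i - ξ j‖ := by
  rw [toRot, toRot, ← mul_sub, norm_mul, norm_exp_ofReal_mul_I, one_mul, EuclideanSpace.norm_eq,
    Fin.sum_univ_two, Complex.norm_eq_sqrt_sq_add_sq]
  simp

theorem abs_sub_le_spread_toRot (θ : ℝ) (ξ : ArrayState m) (i j : Fin m) :
    |ξ j 1 - ξ i 1| ≤ spread (toRot θ ξ) := by
  rw [← re_phaseDir_toRot θ]
  exact (abs_re_phaseDir_le _ _).trans (norm_sub_le_spread _ _ _)

theorem harmonicArray_zero (γ : Fin m → Fin m → ℝ → ℝ) (ξ : ArrayState m) (ω : ℝ) (i : Fin m) :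
    harmonicArray γ ξ ω i 0 = ω * ξ i 1 := rfl

theorem harmonicArray_one {γ : Fin m → Fin m → ℝ → ℝ} (h0 : ∀ i, γ i i 0 = 0) (ξ : ArrayState m)
    (ω : ℝ) (i : Fin m) :
    harmonicArray γ ξ ω i 1 = -ω * ξ i 0 + ∑ j, γ i j (ξ j 1 - ξ i 1) := by
  change -ω * ξ i 0 + ∑ j ∈ Finset.univ.filter (fun j => j ≠ i), γ i j (ξ j 1 - ξ i 1) = _
  congr 1
  refine Finset.sum_subset (Finset.filter_subset _ _) fun j _ hj => ?_
  have : j = i := by simpa using hj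
  rw [this, sub_self, h0]

theorem rotField_toRot (g : Fin m → Fin m → ℝ → ℝ) (θ : ℝ) (ξ : ArrayState m) (i : Fin m) :
    rotField g θ (toRot θ ξ) i =
      exp (θ * I) * (I * ((∑ j, g i j (ξ j 1 - ξ i 1) : ℝ) : ℂ)) := by
  simp only [rotField, kick, re_phaseDir_toRot, ← Finset.sum_mul]
  rw [phaseDir]
  push_cast
  ring

theorem hasDerivAt_exp_mul_I (ω t : ℝ) :
    HasDerivAt (fun t : ℝ => exp ((ω * t : ℝ) * I)) (exp ((ω * t : ℝ) * I) * (ω * I)) t := by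
  have h1 : HasDerivAt (fun t : ℝ => ((ω * t : ℝ) : ℂ)) ω t := by
    simpa using ((hasDerivAt_id t).const_mul ω).ofReal_comp
  exact (h1.mul_const I).cexp

/-- The uncoupled part sends `q + I p` to `-I ω (q + I p)`, which the derivative of the factor
`e^{iωt}` cancels; only the coupling remains. -/
theorem isIntegralCurveOn_toRot {g : Fin m → Fin m → ℝ → ℝ} (h0 : ∀ i, g i i 0 = 0) {ω : ℝ}
    {s : Set ℝ} {ξ : ℝ → ArrayState m}
    (hξ : IsIntegralCurveOn ξ (fun _ v => harmonicArray g v ω) s) :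
    IsIntegralCurveOn (fun t => toRot (ω * t) (ξ t)) (fun t => rotField g (ω * t)) s := by
  intro t ht
  have h := isIntegralCurveOn_arrayState.1 hξ t ht
  refine hasDerivWithinAt_pi.2 fun i => ?_
  have h1 : HasDerivWithinAt (fun t => (ξ t i 0 : ℂ) + (ξ t i 1 : ℂ) * I)
      ((harmonicArray g (ξ t) ω i 0 : ℂ) + (harmonicArray g (ξ t) ω i 1 : ℂ) * I) s t :=
    ((h i 0).ofReal_comp).add (((h i 1).ofReal_comp).mul_const I)
  have h2 := (hasDerivAt_exp_mul_I ω t).hasDerivWithinAt.mul h1 (s := s)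
  beta_reduce
  rw [rotField_toRot]
  simp only [toRot, mk_eq_add_mul_I]
  refine h2.congr_deriv ?_
  rw [harmonicArray_zero, harmonicArray_one h0]
  push_cast
  linear_combination (exp ((ω : ℂ) * t * I) * ω * (ξ t i 1 : ℂ)) * I_mul_I

theorem isIntegralCurveOn_ofRot {g : Fin m → Fin m → ℝ → ℝ} (h0 : ∀ i, g i i 0 = 0) {ω : ℝ}
    {s : Set ℝ} {x : ℝ → Fin m → ℂ}
    (hx : IsIntegralCurveOn x (fun t => rotField g (ω * t)) s) :
    IsIntegralCurveOn (fun t => ofRot (ω * t) (x t)) (fun _ v => harmonicArray g v ω) s := by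
  set ξ : ℝ → ArrayState m := fun t => ofRot (ω * t) (x t) with hξ
  refine isIntegralCurveOn_arrayState.2 fun t ht => ?_
  have key : ∀ i, HasDerivWithinAt (fun t => conj (exp ((ω * t : ℝ) * I)) * x t i)
      ((harmonicArray g (ξ t) ω i 0 : ℂ) + (harmonicArray g (ξ t) ω i 1 : ℂ) * I) s t := by
    intro i
    have h1 := (hasDerivWithinAt_pi.1 (hx t ht)) i
    have h2 : HasDerivAt (fun t : ℝ => conj (exp ((ω * t : ℝ) * I)))
        (conj (exp ((ω * t : ℝ) * I) * (ω * I))) t :=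
      (conjCLE.toContinuousLinearMap.hasFDerivAt.comp_hasDerivAt t (hasDerivAt_exp_mul_I ω t))
    refine (h2.hasDerivWithinAt.mul h1).congr_deriv ?_
    have hxt : x t = toRot (ω * t) (ξ t) := (toRot_ofRot _ _).symm
    beta_reduce
    rw [hxt, rotField_toRot, harmonicArray_zero, harmonicArray_one h0, toRot]
    simp only [map_mul, conj_ofReal, conj_I, mk_eq_add_mul_I, ofReal_add, ofReal_mul, ofReal_neg]
    have h3 := conj_exp_mul_exp (ω * t)
    simp only [ofReal_mul] at h3
    linear_combination (-(ω : ℂ) * I * ((ξ t i 0 : ℂ) + (ξ t i 1 : ℂ) * I) +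
      I * ((∑ j, g i j (ξ t j 1 - ξ t i 1) : ℝ) : ℂ)) * h3 - ω * (ξ t i 1 : ℂ) * I_mul_I
  intro i c
  fin_cases c
  · exact (reCLM.hasFDerivAt.comp_hasDerivWithinAt t (key i)).congr_deriv (by simp)
  · exact (imCLM.hasFDerivAt.comp_hasDerivWithinAt t (key i)).congr_deriv (by simp)

end RotatingFrame

/-! ### Spread versus distance to the synchronization manifold -/

section SyncManifold

open Set

variable {m : ℕ}

theorem isClosed_syncManifold : IsClosed (syncManifold m) := by
  simp only [syncManifold, ofPred_forall]
  exact isClosed_iInter fun i => isClosed_iInter fun j => isClosed_eq (by fun_prop) (by fun_prop)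

theorem syncManifold_nonempty : (syncManifold m).Nonempty := ⟨0, fun _ _ => rfl⟩

/-- A synchronized state drops out of every difference `ξ i - ξ j`, so the triangle inequality
through it costs a factor of two. -/
theorem spread_toRot_le_infDist (θ : ℝ) (ξ : ArrayState m) :
    spread (toRot θ ξ) ≤ 2 * Metric.infDist ξ (syncManifold m) := by
  rw [← div_le_iff₀' two_pos]
  refine (Metric.le_infDist syncManifold_nonempty).2 fun a ha => ?_
  rw [div_le_iff₀' two_pos, spread_le_iff (by positivity)]
  intro i j
  have e : ξ i - ξ j = (ξ - a) i - (ξ - a) j := by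
    rw [PiLp.sub_apply, PiLp.sub_apply, ha i j]; abel
  rw [norm_toRot_sub, e, dist_eq_norm]
  linarith [norm_sub_le ((ξ - a) i) ((ξ - a) j), PiLp.norm_apply_le (ξ - a) i,
    PiLp.norm_apply_le (ξ - a) j]

/-- Compare with the synchronized state placing every node at `ξ l`; the sharper factor `√m` is
relaxed to `m`. -/
theorem infDist_le_spread_toRot (l : Fin m) (θ : ℝ) (ξ : ArrayState m) :
    Metric.infDist ξ (syncManifold m) ≤ m * spread (toRot θ ξ) := by
  set a : ArrayState m := WithLp.toLp 2 fun _ => ξ l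
  refine (Metric.infDist_le_dist_of_mem (show a ∈ syncManifold m from fun _ _ => rfl)).trans ?_
  rw [dist_eq_norm, PiLp.norm_eq_of_L2]
  refine Real.sqrt_le_iff.2 ⟨mul_nonneg (by positivity) (spread_nonneg _), ?_⟩
  calc ∑ i, ‖(ξ - a) i‖ ^ 2 ≤ ∑ _i : Fin m, spread (toRot θ ξ) ^ 2 := by
        refine Finset.sum_le_sum fun i _ => ?_
        gcongr
        have := norm_sub_le_spread (toRot θ ξ) i l
        rwa [norm_toRot_sub] at this
    _ = m * spread (toRot θ ξ) ^ 2 := by simp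
    _ ≤ (m * m) * spread (toRot θ ξ) ^ 2 := by
        gcongr
        exact_mod_cast Nat.le_mul_self m
    _ = _ := by ring

end SyncManifold

/-! ### Reduction to bounded, globally Lipschitz couplings -/

section Truncation

open Set

variable {m : ℕ} {γ : Fin m → Fin m → ℝ → ℝ}

/-- The couplings with their arguments clamped to `[-R, R]`. -/
noncomputable def clampCoupling (γ : Fin m → Fin m → ℝ → ℝ) (R : ℝ) :
    Fin m → Fin m → ℝ → ℝ :=
  -- The hypotheses leave `γ i i` arbitrary, so the diagonal is reset to zero.
  fun i j s => if i = j then 0 else γ i j (max (-R) (min R s))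

theorem clampCoupling_self (γ : Fin m → Fin m → ℝ → ℝ) (R : ℝ) (i : Fin m) :
    clampCoupling γ R i i 0 = 0 := if_pos rfl

theorem clampCoupling_of_ne {R : ℝ} {i j : Fin m} (hij : i ≠ j) (s : ℝ) :
    clampCoupling γ R i j s = γ i j (max (-R) (min R s)) := if_neg hij

theorem lipschitzWith_clamp (R : ℝ) : LipschitzWith 1 fun s : ℝ => max (-R) (min R s) :=
  (LipschitzWith.id.const_min R).const_max (-R)

/-- A locally Lipschitz function is Lipschitz on the compact `[-R, R]`, and clamping is
`1`-Lipschitz. As `R > 0`, clamping keeps the sign of `s`, so the sign condition survives; along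
edges the class-`𝒦` bound excludes zeros away from `0`. -/
theorem exists_isTameCoupling (hγ : IsInterconnection γ)
    (hLip : ∀ i j : Fin m, i ≠ j → LocallyLipschitz (γ i j)) {R : ℝ} (hR : 0 < R) :
    ∃ K B, IsTameCoupling (interconnectionGraph γ).Adj (clampCoupling γ R) K B := by
  have hK : ∀ i j, ∃ K, LipschitzWith K (clampCoupling γ R i j) := by
    intro i j
    by_cases hij : i = j
    · refine ⟨0, ?_⟩
      have : clampCoupling γ R i j = fun _ => 0 := by funext s; exact if_pos hij
      rw [this]; exact LipschitzWith.const _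
    · obtain ⟨K, hK⟩ := LocallyLipschitzOn.exists_lipschitzOnWith_of_compact
        (isCompact_Icc (a := -R) (b := R)) (hLip i j hij).locallyLipschitzOn
      refine ⟨K * 1, ?_⟩
      have e : clampCoupling γ R i j = γ i j ∘ fun s => max (-R) (min R s) := by
        funext s; exact clampCoupling_of_ne hij s
      rw [e, ← lipschitzOnWith_univ]
      exact hK.comp (lipschitzWith_clamp R).lipschitzOnWith fun s _ =>
        ⟨le_max_left _ _, max_le (by linarith) (min_le_left _ _)⟩
  choose k hk using hK
  set K : ℝ≥0 := ∑ p : Fin m × Fin m, k p.1 p.2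
  have hkK : ∀ i j, LipschitzWith K (clampCoupling γ R i j) := fun i j =>
    (hk i j).weaken (Finset.single_le_sum (f := fun p : Fin m × Fin m => k p.1 p.2)
      (fun _ _ => zero_le) (Finset.mem_univ (i, j)))
  have h0 : ∀ i j, clampCoupling γ R i j 0 = 0 := by
    intro i j
    by_cases hij : i = j
    · exact if_pos hij
    · rw [clampCoupling_of_ne hij, min_eq_right hR.le, max_eq_right (by linarith)]
      exact (hγ i j hij).1
  refine ⟨K, K * R, hkK, fun i j s => ?_, h0, fun i j s => ?_, fun i j hij s hs => ?_⟩
  · have e : clampCoupling γ R i j s = clampCoupling γ R i j (max (-R) (min R s)) := by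
      have : max (-R) (min R (max (-R) (min R s))) = max (-R) (min R s) := by
        rw [min_eq_right (max_le (by linarith) (min_le_left _ _)), max_eq_right (le_max_left _ _)]
      simp only [clampCoupling, this]
    have h1 := (hkK i j).norm_sub_le (max (-R) (min R s)) 0
    rw [h0, sub_zero, sub_zero, ← e, Real.norm_eq_abs, Real.norm_eq_abs] at h1
    refine h1.trans (mul_le_mul_of_nonneg_left ?_ K.2)
    exact abs_le.2 ⟨le_max_left _ _, max_le (by linarith) (min_le_left _ _)⟩
  · by_cases hij : i = j
    · simp [clampCoupling, hij]
    · rw [clampCoupling_of_ne hij]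
      have h1 := (hγ i j hij).2.1 (max (-R) (min R s))
      rcases lt_trichotomy s 0 with hs | rfl | hs
      · have h2 : max (-R) (min R s) < 0 :=
          max_lt (by linarith) ((min_le_right _ _).trans_lt hs)
        exact mul_nonneg_of_nonpos_of_nonpos hs.le (nonpos_of_mul_nonneg_right h1 h2)
      · simp
      · have h2 : 0 < max (-R) (min R s) := lt_max_of_lt_right (lt_min hR hs)
        exact mul_nonneg hs.le (nonneg_of_mul_nonneg_right h1 h2)
  · obtain ⟨hne, s', hs'⟩ := hij
    rw [clampCoupling_of_ne hne]
    rcases (hγ i j hne).2.2 with h | ⟨α, ⟨_, hα0, hα⟩, hle⟩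
    · exact absurd (h s') hs'
    · have h2 : max (-R) (min R s) ≠ 0 := by
        rcases lt_or_gt_of_ne hs with hs | hs
        · exact (max_lt (by linarith) ((min_le_right _ _).trans_lt hs)).ne
        · exact (lt_max_of_lt_right (lt_min hR hs)).ne'
      have h3 : 0 < α ‖max (-R) (min R s)‖₊ := by
        rw [← hα0]; exact hα (nnnorm_pos.2 h2)
      exact abs_pos.1 (lt_of_lt_of_le (by exact_mod_cast h3) (hle _))

theorem harmonicArray_clampCoupling {R : ℝ} {ξ : ArrayState m}
    (h : ∀ i j : Fin m, |ξ j 1 - ξ i 1| ≤ R) (ω : ℝ) :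
    harmonicArray (clampCoupling γ R) ξ ω = harmonicArray γ ξ ω := by
  unfold harmonicArray
  congr 1
  funext i
  congr 3
  congr 1
  refine Finset.sum_congr rfl fun j hj => ?_
  have hij : i ≠ j := fun hij => (Finset.mem_filter.1 hj).2 hij.symm
  obtain ⟨h1, h2⟩ := abs_le.1 (h i j)
  rw [clampCoupling_of_ne hij, min_eq_right h2, max_eq_right h1]

end Truncation

/-! ### Existence, uniqueness and completeness -/

section Completeness

open Set

variable {m : ℕ} {γ : Fin m → Fin m → ℝ → ℝ}

/-- Coordinates of solutions grow at most exponentially, at a rate independent of the couplings. -/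
theorem abs_le_exp_of_isIntegralCurveOn {adj : Fin m → Fin m → Prop} {g : Fin m → Fin m → ℝ → ℝ}
    {K : ℝ≥0} {B : ℝ} (hg : IsTameCoupling adj g K B) {ω M a T : ℝ} (hω : 0 < ω)
    {ξ : ℝ → ArrayState m}
    (hξ : IsIntegralCurveOn ξ (fun _ v => harmonicArray g v ω) (Icc a T))
    (h0 : ∀ (i : Fin m) (c : Fin 2), |ξ a i c| ≤ M) {t : ℝ} (ht : t ∈ Icc a T) (i : Fin m)
    (c : Fin 2) : |ξ t i c| ≤ M * Real.exp (ω * (t - a)) := by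
  have hder := isIntegralCurveOn_arrayState.1 hξ
  set σ : Bool → ℝ := fun s => if s then 1 else -1 with hσ
  have hσn : ∀ s, σ (!s) = -σ s := fun s => by cases s <;> simp [hσ]
  have hσsq : ∀ s, σ s * σ s = 1 := fun s => by cases s <;> simp [hσ]
  have hσabs : ∀ s, |σ s| = 1 := fun s => by cases s <;> simp [hσ]
  -- These are the gaps between the barrier and both signs of every coordinate. The barrier grows at
  -- rate `ω`, so the rotation turns each gap's derivative into `ω` times another gap. `K` enters
  -- only the cooperativity constant and hence not the final bound.
  set b : (Fin 2 × Bool) × Fin m → ℝ → ℝ := fun k t =>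
    M * Real.exp (ω * (t - a)) - σ k.1.2 * ξ t k.2 k.1.1 with hb
  set b' : (Fin 2 × Bool) × Fin m → ℝ → ℝ := fun k t =>
    ω * (M * Real.exp (ω * (t - a))) - σ k.1.2 * harmonicArray g (ξ t) ω k.2 k.1.1 with hb'
  have hbd : ∀ k, ∀ t ∈ Icc a T, HasDerivWithinAt (b k) (b' k t) (Icc a T) t := by
    intro k t ht
    refine HasDerivWithinAt.sub (HasDerivAt.hasDerivWithinAt ?_)
      ((hder t ht k.2 k.1.1).const_mul _)
    have h1 : HasDerivAt (fun t => Real.exp (ω * (t - a))) (Real.exp (ω * (t - a)) * (ω * 1)) t :=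
      (((hasDerivAt_id t).sub_const a).const_mul ω).exp
    exact (h1.const_mul M).congr_deriv (by ring)
  have hcoop : ∀ k, ∀ t ∈ Icc a T, b k t < 0 → -(ω + K) * ∑ l, max (-b l t) 0 ≤ b' k t := by
    rintro ⟨⟨c, s⟩, i⟩ t ht hneg
    set n : (Fin 2 × Bool) × Fin m → ℝ := fun l => max (-b l t) 0 with hn
    have hn0 : ∀ l, 0 ≤ n l := fun l => le_max_right _ _
    have hnb : ∀ l, -n l ≤ b l t := fun l => by linarith [le_max_left (-b l t) 0]
    have hrow : ∀ p, ∑ j, n (p, j) ≤ ∑ l, n l := fun p => by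
      rw [Fintype.sum_prod_type]
      exact Finset.single_le_sum (f := fun p => ∑ j, n (p, j))
        (fun p _ => Finset.sum_nonneg fun j _ => hn0 _) (Finset.mem_univ p)
    have hone : ∀ l, n l ≤ ∑ l, n l := fun l =>
      Finset.single_le_sum (fun l _ => hn0 l) (Finset.mem_univ l)
    have hsum0 : 0 ≤ ∑ l, n l := Finset.sum_nonneg fun l _ => hn0 l
    have hK : (0 : ℝ) ≤ K := K.2
    fin_cases c
    · have e : b' ((0, s), i) t = ω * b ((1, s), i) t := by
        simp only [hb, hb', harmonicArray_zero]; ring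
      change _ ≤ b' ((0, s), i) t
      rw [e]
      nlinarith [hnb ((1, s), i), hone ((1, s), i)]
    · have e : b' ((1, s), i) t = ω * b ((0, !s), i) t +
          ∑ j, -(σ s * g i j (ξ t j 1 - ξ t i 1)) := by
        simp only [hb, hb', harmonicArray_one (fun i => hg.map_zero i i), hσn, Finset.sum_neg_distrib,
          ← Finset.mul_sum]
        ring
      -- The coupling can push node `i` further past the barrier only if `j` lies further beyond it;
      -- the difference is then at most the violation `n ((1, s), j)`.
      have hterm : ∀ j, K * -n ((1, s), j) ≤ -(σ s * g i j (ξ t j 1 - ξ t i 1)) := by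
        intro j
        set d := ξ t j 1 - ξ t i 1 with hd
        have hdb : σ s * d = b ((1, s), i) t - b ((1, s), j) t := by simp only [hb, hd]; ring
        have hsgn := hg.sign i j d
        have hprod : (σ s * d) * (σ s * g i j d) = d * g i j d := by
          linear_combination (d * g i j d) * hσsq s
        have hKn : 0 ≤ K * n ((1, s), j) := mul_nonneg hK (hn0 _)
        rcases lt_trichotomy (σ s * d) 0 with h | h | h
        · have : σ s * g i j d ≤ 0 := nonpos_of_mul_nonneg_right (hprod ▸ hsgn) h
          linarith
        · have hd0 : d = 0 := by
            have := congrArg (σ s * ·) h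
            simp only [← mul_assoc, hσsq, one_mul, mul_zero] at this
            exact this
          rw [hd0, hg.map_zero]; linarith
        · have h1 := (hg.lipschitz i j).norm_sub_le d 0
          rw [hg.map_zero, sub_zero, sub_zero, Real.norm_eq_abs, Real.norm_eq_abs] at h1
          have h2 : |d| = σ s * d := by
            rw [← abs_of_pos h, abs_mul, hσabs, one_mul]
          have h3 : σ s * g i j d ≤ |g i j d| := by
            refine (le_abs_self _).trans ?_
            rw [abs_mul, hσabs, one_mul]
          have h4 : σ s * d ≤ n ((1, s), j) := by
            have : b ((1, s), i) t < 0 := hneg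
            linarith [hnb ((1, s), j)]
          have h5 := mul_le_mul_of_nonneg_left h4 hK
          rw [h2] at h1
          linarith
      have hsum := Finset.sum_le_sum fun j (_ : j ∈ Finset.univ) => hterm j
      rw [← Finset.mul_sum, Finset.sum_neg_distrib] at hsum
      change _ ≤ b' ((1, s), i) t
      rw [e]
      have h6 := mul_le_mul_of_nonneg_left (hrow (1, s)) hK
      have h7 := mul_le_mul_of_nonneg_left (hone ((0, !s), i)) hω.le
      have h8 := mul_le_mul_of_nonneg_left (hnb ((0, !s), i)) hω.le
      linarith
  have hpos := nonneg_of_cooperative (add_nonneg hω.le K.2) hbd hcoop fun k => by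
    have h1 := (le_abs_self (σ k.1.2 * ξ a k.2 k.1.1))
    rw [abs_mul, hσabs, one_mul] at h1
    simp only [hb, sub_self, mul_zero, Real.exp_zero, mul_one]
    linarith [h0 k.2 k.1.1]
  have h1 := hpos ((c, true), i) t ht
  have h2 := hpos ((c, false), i) t ht
  simp only [hb, hσ, if_true, Bool.false_eq_true, if_false] at h1 h2
  exact abs_le.2 ⟨by linarith, by linarith⟩

/-- The growth bound does not involve the clamp, so `R` can be chosen first, as twice the bound at
time `T`; the clamped solution then never feels the clamp. -/
theorem exists_solution_Icc (hγ : IsInterconnection γ)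
    (hLip : ∀ i j : Fin m, i ≠ j → LocallyLipschitz (γ i j)) (l : Fin m) {ω a T : ℝ} (hω : 0 < ω)
    (haT : a ≤ T) (ξ₀ : ArrayState m) :
    ∃ ξ : ℝ → ArrayState m, ξ a = ξ₀ ∧
      IsIntegralCurveOn ξ (fun _ v => harmonicArray γ v ω) (Icc a T) := by
  set M : ℝ := ‖ξ₀‖ + 1
  have hM : ∀ (i : Fin m) (c : Fin 2), |ξ₀ i c| ≤ M := fun i c => by
    have h1 := PiLp.norm_apply_le ξ₀ i
    have h2 := PiLp.norm_apply_le (ξ₀ i) c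
    rw [Real.norm_eq_abs] at h2
    simp only [M]; linarith
  have hM0 : 0 < M := by positivity
  set R : ℝ := 2 * (M * Real.exp (ω * (T - a)))
  have hR : 0 < R := by positivity
  obtain ⟨K, B, hg⟩ := exists_isTameCoupling hγ hLip hR
  have hB := hg.bound_nonneg l
  obtain ⟨x, hx0, hx⟩ := exists_isIntegralCurveOn_Icc
    (f := fun t => rotField (clampCoupling γ R) (ω * t))
    (fun t => hg.lipschitzWith_rotField _)
    (fun x => (hg.continuous_rotField x).comp (continuous_const.mul continuous_id))
    (fun t x => hg.norm_rotField_le hB _ _) haT (toRot (ω * a) ξ₀)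
  have hξ := isIntegralCurveOn_ofRot (clampCoupling_self γ R) hx
  have hξa : ofRot (ω * a) (x a) = ξ₀ := by rw [hx0, ofRot_toRot]
  refine ⟨fun t => ofRot (ω * t) (x t), hξa, fun t ht => ?_⟩
  have hgrow := abs_le_exp_of_isIntegralCurveOn hg hω hξ (M := M)
    (fun i c => by rw [hξa]; exact hM i c) ht
  have hexp : M * Real.exp (ω * (t - a)) ≤ M * Real.exp (ω * (T - a)) := by
    gcongr; exact ht.2
  have h := hξ t ht
  have e := harmonicArray_clampCoupling (γ := γ) (R := R) (ξ := ofRot (ω * t) (x t))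
    (fun i j => by
      refine (abs_sub _ _).trans ?_
      linarith [hgrow i 1, hgrow j 1]) ω
  beta_reduce at h ⊢
  rwa [e] at h

theorem exists_bound_of_continuousOn {ξ : ℝ → ArrayState m} {a b : ℝ}
    (hξ : ContinuousOn ξ (Icc a b)) :
    ∃ R, ∀ t ∈ Icc a b, ∀ i j : Fin m, |ξ t j 1 - ξ t i 1| ≤ R := by
  obtain ⟨C, hC⟩ := isCompact_Icc.exists_bound_of_continuousOn hξ
  refine ⟨C + C, fun t ht i j => ?_⟩
  have h : ∀ k, |ξ t k 1| ≤ C := fun k => by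
    rw [← Real.norm_eq_abs]
    exact (PiLp.norm_apply_le (ξ t k) 1).trans ((PiLp.norm_apply_le (ξ t) k).trans (hC t ht))
  exact (abs_sub _ _).trans (add_le_add (h j) (h i))

/-- Both curves are bounded on the compact interval, so they solve one common clamped system, which
is globally Lipschitz in the rotating frame. -/
theorem solution_unique (hγ : IsInterconnection γ)
    (hLip : ∀ i j : Fin m, i ≠ j → LocallyLipschitz (γ i j)) {ω a b : ℝ} {ξ ζ : ℝ → ArrayState m}
    (hξ : IsIntegralCurveOn ξ (fun _ v => harmonicArray γ v ω) (Icc a b))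
    (hζ : IsIntegralCurveOn ζ (fun _ v => harmonicArray γ v ω) (Icc a b)) (h : ξ a = ζ a) :
    EqOn ξ ζ (Icc a b) := by
  obtain ⟨R₁, hR₁⟩ := exists_bound_of_continuousOn hξ.continuousOn
  obtain ⟨R₂, hR₂⟩ := exists_bound_of_continuousOn hζ.continuousOn
  set R := max 1 (max R₁ R₂)
  have hR1 : R₁ ≤ R := (le_max_left _ _).trans (le_max_right _ _)
  have hR2 : R₂ ≤ R := (le_max_right _ _).trans (le_max_right _ _)
  obtain ⟨K, B, hg⟩ := exists_isTameCoupling hγ hLip (R := R)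
    (one_pos.trans_le (le_max_left _ _))
  have clamp : ∀ {χ : ℝ → ArrayState m},
      IsIntegralCurveOn χ (fun _ v => harmonicArray γ v ω) (Icc a b) →
      (∀ t ∈ Icc a b, ∀ i j : Fin m, |χ t j 1 - χ t i 1| ≤ R) →
      IsIntegralCurveOn (fun t => toRot (ω * t) (χ t))
        (fun t => rotField (clampCoupling γ R) (ω * t)) (Icc a b) := by
    intro χ hχ hb
    refine isIntegralCurveOn_toRot (clampCoupling_self γ R) fun t ht => ?_
    have h := hχ t ht
    beta_reduce at h ⊢
    rwa [harmonicArray_clampCoupling (hb t ht)]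
  have key := IsIntegralCurveOn.eqOn_Icc (fun t => hg.lipschitzWith_rotField _)
    (clamp hξ fun t ht i j => (hR₁ t ht i j).trans hR1)
    (clamp hζ fun t ht i j => (hR₂ t ht i j).trans hR2) (by simp only [h])
  intro t ht
  have := congrArg (ofRot (ω * t)) (key ht)
  simpa only [ofRot_toRot] using this

theorem isForwardComplete_harmonicArray (hγ : IsInterconnection γ)
    (hLip : ∀ i j : Fin m, i ≠ j → LocallyLipschitz (γ i j)) (l : Fin m) {ω : ℝ} (hω : 0 < ω) :
    IsForwardComplete (fun ξ ω _ => harmonicArray γ ξ ω) ω := by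
  intro a ξ₀
  choose ξ hξ0 hξ using fun N : ℕ => exists_solution_Icc hγ hLip l hω
    (le_add_of_nonneg_right (Nat.cast_nonneg N) : a ≤ a + N) ξ₀
  have heq : ∀ N N' : ℕ, N ≤ N' → EqOn (ξ N) (ξ N') (Icc a (a + N)) := by
    intro N N' hN
    have hN' : (N : ℝ) ≤ N' := by exact_mod_cast hN
    exact solution_unique hγ hLip (hξ N) ((hξ N').mono (Icc_subset_Icc le_rfl (by linarith)))
      ((hξ0 N).trans (hξ0 N').symm)
  set ζ : ℝ → ArrayState m := fun t => ξ ⌈t - a⌉₊ t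
  have hζ : ∀ N : ℕ, EqOn ζ (ξ N) (Icc a (a + N)) := by
    intro N t ht
    have h1 : ⌈t - a⌉₊ ≤ N := Nat.ceil_le.2 (by linarith [ht.2])
    exact heq _ N h1 ⟨ht.1, by linarith [Nat.le_ceil (t - a)]⟩
  refine ⟨ζ, fun t ht => ?_, ?_⟩
  -- The extra unit puts `t` strictly before the end of the interval, as a derivative within `Ici a`
  -- requires.
  · set N : ℕ := ⌈t - a⌉₊ + 1
    have htN : t < a + N := by
      simp only [N]; push_cast; linarith [Nat.le_ceil (t - a)]
    have ht' : t ∈ Icc a (a + N) := ⟨ht, htN.le⟩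
    have h1 := (hξ N t ht').congr (hζ N) (hζ N ht')
    have h2 := h1.mono_of_mem_nhdsWithin (s := Ici a)
      (mem_nhdsWithin.2 ⟨Iio (a + N), isOpen_Iio, htN, fun s hs => ⟨hs.2, le_of_lt hs.1⟩⟩)
    beta_reduce at h2 ⊢
    rwa [← hζ N ht'] at h2
  · have := hζ 0 (left_mem_Icc.2 (by simp))
    rw [this, hξ0]

end Completeness

/-! ### Conclusion for the original array -/

section Main

open Set

variable {m : ℕ} {γ : Fin m → Fin m → ℝ → ℝ}

/-- Practical stability of synchronization in terms of the spread of the oscillators. -/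
theorem harmonicArray_spread_practical (hγ : IsInterconnection γ)
    (hLip : ∀ i j : Fin m, i ≠ j → LocallyLipschitz (γ i j)) {l : Fin m}
    (hconn : ∀ i, i ≠ l → Relation.ReflTransGen (interconnectionGraph γ).Adj i l) {c D : ℝ}
    (hc : 0 < c) (hcD : c ≤ D) :
    ∃ ω₀ > 0, ∀ ω, ω₀ ≤ ω → ∃ T > 0, ∀ (a : ℝ) (ξ : ℝ → ArrayState m),
      IsForwardSolution (fun ξ ω _ => harmonicArray γ ξ ω) ω a ξ →
      spread (toRot (ω * a) (ξ a)) ≤ D → ∀ t, a ≤ t →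
        spread (toRot (ω * t) (ξ t)) ≤ D + c ∧
        (spread (toRot (ω * a) (ξ a)) ≤ c / 2 → spread (toRot (ω * t) (ξ t)) ≤ c) ∧
        (a + T ≤ t → spread (toRot (ω * t) (ξ t)) ≤ c) := by
  have hR : 0 < D + c := by linarith
  -- The clamp level `D + c` is exactly the spread bound that `spread_practical` gives for the
  -- clamped system, so its solution also solves the original one.
  obtain ⟨K, B, hg⟩ := exists_isTameCoupling hγ hLip hR
  have hB := hg.bound_nonneg l
  obtain ⟨ω₀, hω₀, H⟩ := spread_practical hg hconn hc hcD
  refine ⟨ω₀, hω₀, fun ω hω => ?_⟩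
  obtain ⟨τ, hτ, T, hT, H⟩ := H ω hω
  refine ⟨T, hT, fun a ξ hξ hD t hat => ?_⟩
  set N : ℕ := ⌈(t - a) / τ⌉₊
  have hNτ : t ≤ a + N * τ := by
    have := (div_le_iff₀ hτ).1 (Nat.le_ceil ((t - a) / τ))
    linarith
  obtain ⟨x, hx0, hx⟩ := exists_isIntegralCurveOn_Icc
    (f := fun t => rotField (clampCoupling γ (D + c)) (ω * t))
    (fun t => hg.lipschitzWith_rotField _)
    (fun x => (hg.continuous_rotField x).comp (continuous_const.mul continuous_id))
    (fun t x => hg.norm_rotField_le hB _ _) (hat.trans hNτ) (toRot (ω * a) (ξ a))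
  have Hx := H N a x hx (by rwa [hx0])
  have hofRot : IsIntegralCurveOn (fun t => ofRot (ω * t) (x t))
      (fun _ v => harmonicArray γ v ω) (Icc a (a + N * τ)) := by
    intro s hs
    have h := isIntegralCurveOn_ofRot (clampCoupling_self γ (D + c)) hx s hs
    have e := harmonicArray_clampCoupling (γ := γ) (R := D + c) (ξ := ofRot (ω * s) (x s))
      (fun i j => by
        refine (abs_sub_le_spread_toRot (ω * s) _ i j).trans ?_
        rw [toRot_ofRot]
        exact (Hx s hs).1) ω
    beta_reduce at h ⊢
    rwa [e] at h
  have heq := solution_unique hγ hLip (hξ.mono Icc_subset_Ici_self) hofRot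
    (by rw [hx0, ofRot_toRot]) ⟨hat, hNτ⟩
  have ht := Hx t ⟨hat, hNτ⟩
  rw [hx0] at ht
  have e : toRot (ω * t) (ξ t) = x t := by rw [heq, toRot_ofRot]
  rwa [e]

theorem mainTheorem2 (m : ℕ) (γ : Fin m → Fin m → ℝ → ℝ)
    (hγ : IsInterconnection γ)
    (hLip : ∀ i j : Fin m, i ≠ j → LocallyLipschitz (γ i j))
    (hconn : DigraphConnected (interconnectionGraph γ)) :
    (∀ ω : ℝ, 0 < ω → IsForwardComplete (fun ξ ω _ => harmonicArray γ ξ ω) ω) ∧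
    IsSemigloballyPracticallyAsymptoticallyStable
      (fun ξ ω _ => harmonicArray γ ξ ω) (syncManifold m) := by
  obtain ⟨l, hl⟩ := hconn
  refine ⟨fun ω hω => isForwardComplete_harmonicArray hγ hLip l hω, isClosed_syncManifold,
    fun Δ δ hΔ hδ => ?_⟩
  have hm : (0 : ℝ) < m := by exact_mod_cast l.pos
  -- Distance is at most `m` times spread, so spread `c` means distance at most `δ`. Spread is at
  -- most twice distance, hence `2 * Δ` in `D`, and `ε = c / 4` in (a) to start with spread at most
  -- `c / 2`.
  set c : ℝ := δ / m
  have hc : 0 < c := by positivity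
  have hmc : m * c = δ := mul_div_cancel₀ _ hm.ne'
  set D : ℝ := max (2 * Δ) c
  have hcD : c ≤ D := le_max_right _ _
  obtain ⟨ω₀, hω₀, H⟩ := harmonicArray_spread_practical hγ hLip hl hc hcD
  have hle : ∀ {θ : ℝ} {ξ : ArrayState m} {r : ℝ}, spread (toRot θ ξ) ≤ r →
      Metric.infDist ξ (syncManifold m) ≤ m * r := fun {θ ξ r} h =>
    (infDist_le_spread_toRot l θ ξ).trans (mul_le_mul_of_nonneg_left h hm.le)
  refine ⟨ω₀, hω₀, fun ω hω => ?_⟩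
  obtain ⟨T, hT, H⟩ := H ω hω
  refine ⟨fun r hr => ⟨c / 4, by positivity, fun a ξ hξ h t ht => ?_⟩,
    fun ε hε => ⟨m * (D + c), by positivity, fun a ξ hξ h t ht => ?_⟩,
    fun r ε hr hε => ⟨T, hT, fun a ξ hξ h t ht => ?_⟩⟩ <;>
  have hs := spread_toRot_le_infDist (ω * a) (ξ a)
  · have := hle ((H a ξ hξ (by linarith) t ht).2.1 (by linarith))
    linarith
  · exact hle (H a ξ hξ (by linarith [le_max_left (2 * Δ) c]) t ht).1
  · have := hle ((H a ξ hξ (by linarith [le_max_left (2 * Δ) c]) t (by linarith)).2.2 ht)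
    linarith

end Main
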